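/- A \emph{topological groupoid} $\mathbb{X}=(X_1\rightrightarrows X_0)$ is a small groupoid whose sets of objects $X_0$ and of arrows $X_1$ carry topologies making source $s$, target $t$, identities, inversion and composition continuous; it is \emph{open} if $s$ is an open map. A continuous functor is a functor that is continuous on objects and on arrows; a continuous transformation $a\colon\Phi\Rightarrow\Psi$ between continuous functors $\mathbb{X}\to\mathbb{Y}$ is a natural transformation for which $X_0\to Y_1$, $x\mapsto a_x$, is continuous. A \emph{sheaf} on $\mathbb{X}$ is a local homeomorphism $q\colon W\to X_0$ with a continuous (unital, associative) action $X_1\times_{X_0}W\to W$, $(g,w)\mapsto g\cdot w$ for $s(g)=q(w)$, with $q(g\cdot w)=t(g)$; morphisms of sheaves are continuous equivariant maps over $X_0$. These form the topos $\mathrm{Sh}(\mathbb{X})$. A continuous functor $\Phi\colon\mathbb{X}\to\mathbb{Y}$ induces a geometric morphism $\mathrm{Sh}(\Phi)\colon\mathrm{Sh}(\mathbb{X})\to\mathrm{Sh}(\mathbb{Y})$ whose inverse image sends $W$ to $\Phi_0^*W=X_0\times_{Y_0}W$ with the action $g\cdot(s(g),w)=(t(g),\Phi_1(g)\cdot w)$,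 and a continuous transformation $a\colon\Phi\Rightarrow\Psi$ induces the natural transformation $\mathrm{Sh}(a)\colon\mathrm{Sh}(\Phi)^*\Rightarrow\mathrm{Sh}(\Psi)^*$, $(x,w)\mapsto(x,a_x\cdot w)$. A space is regarded as a topological groupoid with only identity arrows, and $u_{\mathbb{X}}\colon\mathrm{Sh}(X_0)\to\mathrm{Sh}(\mathbb{X})$ is induced by the identity-on-objects functor $X_0\to\mathbb{X}$. An open topological groupoid $\mathbb{X}$ is \emph{étale complete} if $X_0$ and $X_1$ are sober and the square $$\begin{array}{ccc}\mathrm{Sh}(X_1)&\xrightarrow{\ \mathrm{Sh}(s)\ }&\mathrm{Sh}(X_0)\\ {\scriptstyle\mathrm{Sh}(t)}\downarrow&&\downarrow{\scriptstyle u_{\mathbb{X}}}\\ \mathrm{Sh}(X_0)&\xrightarrow{\ u_{\mathbb{X}}\ }&\mathrm{Sh}(\mathbb{X})\end{array}$$ filled by the canonical isomorphism $u_{\mathbb{X}}\circ\mathrm{Sh}(s)\cong u_{\mathbb{X}}\circ\mathrm{Sh}(t)$, $(g,w)\mapsto(g,g\cdot w)$, is a bi-pullback in the bi-category of Grothendieck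 topoi with enough points, geometric morphisms and natural transformations between inverse image functors. \textbf{Lemma.} Let $\mathbb{X}$ and $\mathbb{Y}$ be étale complete topological groupoids. Then the functor $$\mathrm{Sh}\colon\mathbf{ECTGrpd}(\mathbb{X},\mathbb{Y})\to\mathbf{Topos}^{\mathrm{iso}}_{\mathrm{w.e.p.}}(\mathrm{Sh}(\mathbb{X}),\mathrm{Sh}(\mathbb{Y})),\qquad \Phi\mapsto\mathrm{Sh}(\Phi),\ a\mapsto\mathrm{Sh}(a),$$ from the category of continuous functors $\mathbb{X}\to\mathbb{Y}$ and continuous transformations to the category of geometric morphisms $\mathrm{Sh}(\mathbb{X})\to\mathrm{Sh}(\mathbb{Y})$ and natural isomorphisms between their inverse image functors is full and faithful. That is, for all continuous functors $\Phi,\Psi\colon\mathbb{X}\to\mathbb{Y}$, the map $a\mapsto\mathrm{Sh}(a)$ is a bijection from continuous transformations $\Phi\Rightarrow\Psi$ to natural isomorphisms $\mathrm{Sh}(\Phi)^*\cong\mathrm{Sh}(\Psi)^*$. -/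

import Mathlib

open CategoryTheory CategoryTheory.Limits Topology

universe u

/-- A topological groupoid: a small groupoid with topologies on the set `Obj` of objects and the set
`Arr` of arrows such that all structure maps are continuous.
For `g : x ⟶ y` and `h : y ⟶ z`, the composite `h ∘ g` is `comp g h _`. -/
structure TopGrpd : Type (u + 1) where
  Obj : Type u
  Arr : Type u
  [topObj : TopologicalSpace Obj]
  [topArr : TopologicalSpace Arr]
  src : Arr → Obj
  tgt : Arr → Obj
  one : Obj → Arr
  inv : Arr → Arr
  comp : (g h : Arr) → tgt g = src h → Arr
  src_one : ∀ x, src (one x) = x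
  tgt_one : ∀ x, tgt (one x) = x
  src_inv : ∀ g, src (inv g) = tgt g
  tgt_inv : ∀ g, tgt (inv g) = src g
  src_comp : ∀ g h e, src (comp g h e) = src g
  tgt_comp : ∀ g h e, tgt (comp g h e) = tgt h
  one_comp : ∀ g, comp (one (src g)) g (tgt_one _) = g
  comp_one : ∀ g, comp g (one (tgt g)) (src_one _).symm = g
  assoc : ∀ f g h (e : tgt f = src g) (e' : tgt g = src h),
    comp (comp f g e) h ((tgt_comp f g e).trans e') =
      comp f (comp g h e') (e.trans (src_comp g h e').symm)
  comp_inv : ∀ g, comp g (inv g) (src_inv g).symm = one (src g)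
  inv_comp : ∀ g, comp (inv g) g (tgt_inv g) = one (tgt g)
  continuous_src : Continuous src
  continuous_tgt : Continuous tgt
  continuous_one : Continuous one
  continuous_inv : Continuous inv
  continuous_comp : Continuous
    (fun p : {p : Arr × Arr // tgt p.1 = src p.2} => comp p.1.1 p.1.2 p.2)

attribute [instance] TopGrpd.topObj TopGrpd.topArr
attribute [simp] TopGrpd.src_one TopGrpd.tgt_one TopGrpd.src_inv TopGrpd.tgt_inv TopGrpd.src_comp
  TopGrpd.tgt_comp TopGrpd.one_comp TopGrpd.comp_one TopGrpd.comp_inv TopGrpd.inv_comp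

namespace TopGrpd

/-- A topological groupoid is open if its source map is open. -/
def IsOpenGrpd (X : TopGrpd.{u}) : Prop := IsOpenMap X.src

/-- Continuous functors of topological groupoids. -/
structure ContFunctor (X Y : TopGrpd.{u}) : Type u where
  obj : X.Obj → Y.Obj
  arr : X.Arr → Y.Arr
  src_arr : ∀ g, Y.src (arr g) = obj (X.src g)
  tgt_arr : ∀ g, Y.tgt (arr g) = obj (X.tgt g)
  arr_one : ∀ x, arr (X.one x) = Y.one (obj x)
  arr_comp : ∀ g h (e : X.tgt g = X.src h), arr (X.comp g h e) =
    Y.comp (arr g) (arr h) ((tgt_arr g).trans ((congrArg obj e).trans (src_arr h).symm))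
  continuous_obj : Continuous obj
  continuous_arr : Continuous arr

attribute [simp] ContFunctor.src_arr ContFunctor.tgt_arr ContFunctor.arr_one

/-- The composite `Ψ ∘ Φ` of continuous functors. -/
def ContFunctor.comp {X Y Z : TopGrpd.{u}} (Φ : ContFunctor X Y) (Ψ : ContFunctor Y Z) :
    ContFunctor X Z where
  obj x := Ψ.obj (Φ.obj x)
  arr g := Ψ.arr (Φ.arr g)
  src_arr g := by simp
  tgt_arr g := by simp
  arr_one x := by simp
  arr_comp g h e := by simp only [Φ.arr_comp, Ψ.arr_comp]
  continuous_obj := Ψ.continuous_obj.comp Φ.continuous_obj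
  continuous_arr := Ψ.continuous_arr.comp Φ.continuous_arr

/-- Continuous natural transformations `Φ ⇒ Ψ` between continuous functors. -/
@[ext]
structure ContTrans {X Y : TopGrpd.{u}} (Φ Ψ : ContFunctor X Y) : Type u where
  app : X.Obj → Y.Arr
  src_app : ∀ x, Y.src (app x) = Φ.obj x
  tgt_app : ∀ x, Y.tgt (app x) = Ψ.obj x
  naturality : ∀ g : X.Arr,
    Y.comp (Φ.arr g) (app (X.tgt g)) ((Φ.tgt_arr g).trans (src_app _).symm) =
      Y.comp (app (X.src g)) (Ψ.arr g) ((tgt_app _).trans (Ψ.src_arr g).symm)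
  continuous_app : Continuous app

attribute [simp] ContTrans.src_app ContTrans.tgt_app

section
variable {X Y : TopGrpd.{u}}

lemma comp_congr {g g' h h' : X.Arr} (hg : g = g') (hh : h = h') (e : X.tgt g = X.src h)
    (e' : X.tgt g' = X.src h') : X.comp g h e = X.comp g' h' e' := by
  subst hg hh
  rfl

lemma continuous_comp' {S : Type*} [TopologicalSpace S] {f g : S → X.Arr} (hf : Continuous f)
    (hg : Continuous g) (h : ∀ s, X.tgt (f s) = X.src (g s)) :
    Continuous fun s => X.comp (f s) (g s) (h s) :=
  X.continuous_comp.comp (Continuous.subtype_mk (hf.prodMk hg) h)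

/-- The identity transformation. -/
def ContTrans.id (Φ : ContFunctor X Y) : ContTrans Φ Φ where
  app x := Y.one (Φ.obj x)
  src_app x := by simp
  tgt_app x := by simp
  naturality g := by
    have h1 := Y.comp_one (Φ.arr g)
    have h2 := Y.one_comp (Φ.arr g)
    simp only [Φ.src_arr, Φ.tgt_arr] at h1 h2
    rw [h1, h2]
  continuous_app := Y.continuous_one.comp Φ.continuous_obj

/-- The composite of `a : Φ ⇒ Ψ` and `b : Ψ ⇒ Θ`, with components `b_x ∘ a_x`. -/
def ContTrans.vcomp {Φ Ψ Θ : ContFunctor X Y} (a : ContTrans Φ Ψ) (b : ContTrans Ψ Θ) :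
    ContTrans Φ Θ where
  app x := Y.comp (a.app x) (b.app x) (by simp)
  src_app x := by simp
  tgt_app x := by simp
  naturality g := by
    calc _ = Y.comp (Y.comp (Φ.arr g) (a.app (X.tgt g)) (by simp)) (b.app (X.tgt g)) (by simp) :=
          (Y.assoc _ _ _ _ _).symm
      _ = Y.comp (Y.comp (a.app (X.src g)) (Ψ.arr g) (by simp)) (b.app (X.tgt g)) (by simp) :=
          comp_congr (a.naturality g) rfl _ _
      _ = Y.comp (a.app (X.src g)) (Y.comp (Ψ.arr g) (b.app (X.tgt g)) (by simp)) (by simp) :=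
          Y.assoc _ _ _ _ _
      _ = Y.comp (a.app (X.src g)) (Y.comp (b.app (X.src g)) (Θ.arr g) (by simp)) (by simp) :=
          comp_congr rfl (b.naturality g) _ _
      _ = _ := (Y.assoc _ _ _ _ _).symm
  continuous_app := continuous_comp' a.continuous_app b.continuous_app (fun x => by simp)

/-- The inverse of a continuous transformation. -/
def ContTrans.inv {Φ Ψ : ContFunctor X Y} (a : ContTrans Φ Ψ) : ContTrans Ψ Φ where
  app x := Y.inv (a.app x)
  src_app x := by simp
  tgt_app x := by simp
  naturality g := by
    have key := a.naturality g
    have e1 : Y.comp (Y.comp (Y.inv (a.app (X.src g))) (Y.comp (a.app (X.src g)) (Ψ.arr g)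
        (by simp)) (by simp)) (Y.inv (a.app (X.tgt g))) (by simp) =
        Y.comp (Ψ.arr g) (Y.inv (a.app (X.tgt g))) (by simp) := by
      simp only [← Y.assoc _ _ _ (Y.tgt_inv _) _, Y.inv_comp]
      have := Y.one_comp (Ψ.arr g)
      simp only [Ψ.src_arr] at this
      simp [this]
    rw [← e1]
    simp only [← key]
    rw [Y.assoc _ _ _ (by simp) (by simp)]
    simp only [Y.assoc _ _ _ _ (Y.src_inv _).symm, Y.comp_inv]
    have := Y.comp_one (Φ.arr g)
    simp only [Φ.tgt_arr] at this
    simp [this]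
  continuous_app := Y.continuous_inv.comp a.continuous_app

/-- The category `TopGrpd(X, Y)` of continuous functors and continuous transformations. -/
instance : Category.{u} (ContFunctor X Y) where
  Hom Φ Ψ := ContTrans Φ Ψ
  id Φ := ContTrans.id Φ
  comp a b := ContTrans.vcomp a b
  id_comp {Φ Ψ} a := by
    apply ContTrans.ext
    funext x
    have := Y.one_comp (a.app x)
    simp only [a.src_app] at this
    exact this
  comp_id {Φ Ψ} a := by
    apply ContTrans.ext
    funext x
    have := Y.comp_one (a.app x)
    simp only [a.tgt_app] at this
    exact this
  assoc a b c := by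
    apply ContTrans.ext
    funext x
    exact Y.assoc _ _ _ _ _

/-- All continuous transformations are invertible, because `Y` is a groupoid. -/
instance : Groupoid.{u} (ContFunctor X Y) where
  inv {Φ Ψ} a := ContTrans.inv (Φ := Φ) (Ψ := Ψ) a
  inv_comp {Φ Ψ} a := by
    apply ContTrans.ext
    funext x
    exact (Y.inv_comp _).trans (congrArg Y.one (ContTrans.tgt_app (Φ := Φ) (Ψ := Ψ) a x))
  comp_inv {Φ Ψ} a := by
    apply ContTrans.ext
    funext x
    exact (Y.comp_inv _).trans (congrArg Y.one (ContTrans.src_app (Φ := Φ) (Ψ := Ψ) a x))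

end

/-- The structure of a sheaf over the topological groupoid `X` on a space `W`: a local
homeomorphism to the space of objects and a continuous action of the arrows. -/
structure SheafStr (X : TopGrpd.{u}) (W : Type u) [TopologicalSpace W] : Type u where
  proj : W → X.Obj
  isLocalHomeomorph_proj : IsLocalHomeomorph proj
  act : (g : X.Arr) → (w : W) → X.src g = proj w → W
  continuous_act : Continuous
    (fun p : {p : X.Arr × W // X.src p.1 = proj p.2} => act p.1.1 p.1.2 p.2)
  proj_act : ∀ g w e, proj (act g w e) = X.tgt g
  act_one : ∀ w, act (X.one (proj w)) w (X.src_one _) = w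
  act_comp : ∀ g h w (e : X.src g = proj w) (e' : X.tgt g = X.src h),
    act h (act g w e) (e'.symm.trans (proj_act g w e).symm) =
      act (X.comp g h e') w ((X.src_comp g h e').trans e)

/-- Sheaves on a topological groupoid. -/
structure Sh (X : TopGrpd.{u}) : Type (u + 1) where
  carrier : Type u
  [top : TopologicalSpace carrier]
  str : SheafStr X carrier

attribute [instance] Sh.top
attribute [simp] SheafStr.proj_act SheafStr.act_one

namespace Sh

variable {X Y Z : TopGrpd.{u}}

instance : CoeSort (Sh X) (Type u) := ⟨Sh.carrier⟩

abbrev proj (W : Sh X) : W → X.Obj := W.str.proj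

abbrev act (W : Sh X) (g : X.Arr) (w : W) (e : X.src g = W.proj w) : W := W.str.act g w e

/-- Morphisms of sheaves: continuous equivariant maps over the space of objects. -/
@[ext]
structure Hom (V W : Sh X) : Type u where
  toFun : V → W
  continuous_toFun : Continuous toFun
  proj_toFun : ∀ v, W.proj (toFun v) = V.proj v
  map_act : ∀ g v (e : X.src g = V.proj v),
    toFun (V.act g v e) = W.act g (toFun v) (e.trans (proj_toFun v).symm)

attribute [simp] Hom.proj_toFun

/-- The category `Sh(X)` of sheaves on a topological groupoid. -/
instance : Category.{u} (Sh X) where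
  Hom V W := Hom V W
  id V := ⟨fun v => v, continuous_id, fun _ => rfl, fun _ _ _ => rfl⟩
  comp {U V W} f g := ⟨fun v => g.toFun (f.toFun v), g.continuous_toFun.comp f.continuous_toFun,
    fun v => by simp, fun k v e => by simp [f.map_act, g.map_act]⟩

@[ext]
lemma hom_ext {V W : Sh X} {f g : V ⟶ W} (h : ∀ v, Hom.toFun f v = Hom.toFun g v) : f = g :=
  Hom.ext (funext h)

@[simp] lemma id_toFun (V : Sh X) (v : V) : Hom.toFun (𝟙 V) v = v := rfl
@[simp] lemma comp_toFun {U V W : Sh X} (f : U ⟶ V) (g : V ⟶ W) (v : U) :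
    Hom.toFun (f ≫ g) v = Hom.toFun g (Hom.toFun f v) := rfl

lemma continuous_act' (W : Sh X) {S : Type*} [TopologicalSpace S] {f : S → X.Arr} {k : S → W}
    (hf : Continuous f) (hk : Continuous k) (h : ∀ s, X.src (f s) = W.proj (k s)) :
    Continuous fun s => W.act (f s) (k s) (h s) :=
  W.str.continuous_act.comp (Continuous.subtype_mk (hf.prodMk hk) h)

lemma continuous_proj (W : Sh X) : Continuous W.proj := W.str.isLocalHomeomorph_proj.continuous

lemma isLocalHomeomorph_of {A B : Type*} [TopologicalSpace A] [TopologicalSpace B] {f : A → B}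
    (hc : Continuous f) (ho : IsOpenMap f) (hi : IsLocallyInjective f) : IsLocalHomeomorph f := by
  rw [isLocalHomeomorph_iff_isOpenEmbedding_restrict]
  intro a
  obtain ⟨U, hU, ha, hinj⟩ := hi a
  refine ⟨U, hU.mem_nhds ha, .of_continuous_injective_isOpenMap
    (hc.comp continuous_subtype_val) (Set.injOn_iff_injective.mp hinj) ?_⟩
  exact ho.comp hU.isOpenMap_subtype_val

/-- The space `A ×_B W` over `A` is étale if `W` is étale over `B`. -/
lemma isLocalHomeomorph_pullback {A B W : Type*} [TopologicalSpace A] [TopologicalSpace B]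
    [TopologicalSpace W] {f : A → B} {q : W → B} (hf : Continuous f) (hq : IsLocalHomeomorph q) :
    IsLocalHomeomorph (fun p : {p : A × W // f p.1 = q p.2} => p.1.1) := by
  refine isLocalHomeomorph_of (by fun_prop) ?_ ?_
  · rw [isOpenMap_iff_nhds_le]
    rintro ⟨⟨a, w⟩, h⟩
    simp only at h
    intro S hS
    rw [Filter.mem_map, nhds_subtype_eq_comap, Filter.mem_comap] at hS
    obtain ⟨T, hT, hTS⟩ := hS
    rw [nhds_prod_eq, Filter.mem_prod_iff] at hT
    obtain ⟨U, hU, V, hV, hUV⟩ := hT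
    have h1 : q '' V ∈ 𝓝 (f a) := by
      rw [h]; exact hq.isOpenMap.image_mem_nhds hV
    filter_upwards [hU, hf.continuousAt.preimage_mem_nhds h1] with b hb hb'
    obtain ⟨v, hv, hv'⟩ := hb'
    exact hTS (show (⟨(b, v), hv'.symm⟩ : {p : A × W // f p.1 = q p.2}) ∈ _ from
      hUV ⟨hb, hv⟩)
  · rintro ⟨⟨a, w⟩, h⟩
    obtain ⟨U, hU, hw, hinj⟩ := hq.isLocallyInjective w
    refine ⟨{p | p.1.2 ∈ U}, hU.preimage (by fun_prop), hw, ?_⟩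
    rintro ⟨⟨a1, w1⟩, h1⟩ hm1 ⟨⟨a2, w2⟩, h2⟩ hm2 heq
    simp only at heq h1 h2
    subst heq
    have := hinj hm1 hm2 (h1.symm.trans h2)
    simp only at this
    subst this
    rfl

/-- The inverse image `Φ₀^* W` of a sheaf along a continuous functor, with the action
`g · (s(g), w) = (t(g), Φ₁(g) · w)`. -/
def invObj (Φ : ContFunctor X Y) (W : Sh Y) : Sh X where
  carrier := {p : X.Obj × W // Φ.obj p.1 = W.proj p.2}
  str :=
    { proj := fun p => p.1.1
      isLocalHomeomorph_proj :=
        isLocalHomeomorph_pullback Φ.continuous_obj W.str.isLocalHomeomorph_proj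
      act := fun g p e => ⟨(X.tgt g, W.act (Φ.arr g) p.1.2
        ((Φ.src_arr g).trans ((congrArg Φ.obj e).trans p.2))), by simp⟩
      continuous_act := by
        refine Continuous.subtype_mk (.prodMk ?_ ?_) _
        · exact X.continuous_tgt.comp (by fun_prop)
        · exact W.continuous_act' (Φ.continuous_arr.comp (by fun_prop)) (by fun_prop) _
      proj_act := fun _ _ _ => rfl
      act_one := by
        rintro ⟨⟨x, w⟩, h⟩
        simp only at h
        simp [h]
      act_comp := by
        rintro g h ⟨⟨x, w⟩, e0⟩ e e'
        apply Subtype.ext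
        refine Prod.ext (by simp) ?_
        simp only [Φ.arr_comp]
        exact W.str.act_comp _ _ _ _ _ }

/-- The inverse image functor `Sh(Φ)^* : Sh(Y) ⥤ Sh(X)` of a continuous functor `Φ : X → Y`. -/
def inverseImage (Φ : ContFunctor X Y) : Sh Y ⥤ Sh X where
  obj W := invObj Φ W
  map {V W} f :=
    { toFun p := ⟨(p.1.1, Hom.toFun f p.1.2), p.2.trans (Hom.proj_toFun f _).symm⟩
      continuous_toFun := by
        refine Continuous.subtype_mk (.prodMk (by fun_prop) ?_) _
        exact (Hom.continuous_toFun f).comp (by fun_prop)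
      proj_toFun _ := rfl
      map_act g p e := by
        apply Subtype.ext
        exact Prod.ext rfl (Hom.map_act f _ _ _) }

/-- The natural transformation `Sh(a) : Sh(Φ)^* ⟶ Sh(Ψ)^*`, `(x, w) ↦ (x, a_x · w)`, induced by a
continuous transformation `a : Φ ⇒ Ψ`. -/
def inverseImageMap {Φ Ψ : ContFunctor X Y} (a : ContTrans Φ Ψ) : inverseImage Φ ⟶ inverseImage Ψ where
  app W :=
    { toFun p := ⟨(p.1.1, W.act (a.app p.1.1) p.1.2
        ((a.src_app _).trans p.2)), by simp⟩
      continuous_toFun := by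
        refine Continuous.subtype_mk (.prodMk (by fun_prop) ?_) _
        exact W.continuous_act' (a.continuous_app.comp (by fun_prop)) (by fun_prop) _
      proj_toFun _ := rfl
      map_act g p e := by
        apply Subtype.ext
        refine Prod.ext rfl ?_
        change W.str.act _ (W.str.act _ _ _) _ = W.str.act _ (W.str.act _ _ _) _
        obtain ⟨⟨x, w⟩, h⟩ := p
        change X.src g = x at e
        subst e
        rw [W.str.act_comp _ _ _ _ (by simp; rfl), W.str.act_comp _ _ _ _ (by simp)]
        simp only [← a.naturality]
        rfl }
  naturality V W f := by
    apply hom_ext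
    intro p
    apply Subtype.ext
    exact Prod.ext rfl (Hom.map_act f _ _ _).symm

/-- The canonical isomorphism `Sh(Φ)^* Sh(Ψ)^* ≅ Sh(Ψ ∘ Φ)^*`. -/
def inverseImageComp (Φ : ContFunctor X Y) (Ψ : ContFunctor Y Z) :
    inverseImage Ψ ⋙ inverseImage Φ ≅ inverseImage (Φ.comp Ψ) :=
  NatIso.ofComponents (fun W =>
    { hom :=
        { toFun p := ⟨(p.1.1, p.1.2.1.2), (congrArg Ψ.obj p.2).trans p.1.2.2⟩
          continuous_toFun := by
            refine Continuous.subtype_mk (.prodMk (by fun_prop) ?_) _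
            exact continuous_snd.comp (continuous_subtype_val.comp
              (continuous_snd.comp continuous_subtype_val))
          proj_toFun _ := rfl
          map_act _ _ _ := rfl }
      inv :=
        { toFun p := ⟨(p.1.1, ⟨(Φ.obj p.1.1, p.1.2), p.2⟩), rfl⟩
          continuous_toFun := by
            refine Continuous.subtype_mk (.prodMk (by fun_prop)
              (Continuous.subtype_mk (.prodMk (Φ.continuous_obj.comp (by fun_prop))
                (by fun_prop)) _)) _
          proj_toFun _ := rfl
          map_act g p e := by
            apply Subtype.ext
            refine Prod.ext rfl ?_
            apply Subtype.ext
            exact Prod.ext (Φ.tgt_arr g).symm rfl }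
      hom_inv_id := by
        apply hom_ext
        rintro ⟨⟨x, ⟨⟨y, w⟩, h⟩⟩, h'⟩
        apply Subtype.ext
        refine Prod.ext rfl ?_
        apply Subtype.ext
        exact Prod.ext h' rfl
      inv_hom_id := by
        apply hom_ext
        intro p
        rfl }) (fun f => rfl)

section LeftExact

/-- A morphism of sheaves is a local homeomorphism. -/
lemma Hom.isLocalHomeomorph {A B : Sh X} (f : A ⟶ B) : IsLocalHomeomorph (Hom.toFun f) := by
  refine IsLocalHomeomorph.of_comp (g := B.proj) ?_ B.str.isLocalHomeomorph_proj
    (Hom.continuous_toFun f)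
  have : B.proj ∘ Hom.toFun f = A.proj := funext (Hom.proj_toFun f)
  rw [this]
  exact A.str.isLocalHomeomorph_proj

lemma act_congr (W : Sh X) {g g' : X.Arr} {w w' : W} (hg : g = g') (hw : w = w')
    (e : X.src g = W.proj w) (e' : X.src g' = W.proj w') : W.act g w e = W.act g' w' e' := by
  subst hg hw
  rfl

/-- The terminal sheaf. -/
def terminal (X : TopGrpd.{u}) : Sh X where
  carrier := X.Obj
  str :=
    { proj := fun x => x
      isLocalHomeomorph_proj := (Homeomorph.refl X.Obj).isLocalHomeomorph
      act := fun g _ _ => X.tgt g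
      continuous_act := X.continuous_tgt.comp (by fun_prop)
      proj_act := fun _ _ _ => rfl
      act_one := fun _ => X.tgt_one _
      act_comp := fun _ _ _ _ _ => (X.tgt_comp _ _ _).symm }

/-- A sheaf with bijective projection is terminal. -/
noncomputable def isTerminalOfBijective (T : Sh X) (hT : Function.Bijective T.proj) :
    IsTerminal T :=
  let e : T ≃ₜ X.Obj := (Equiv.ofBijective _ hT).toHomeomorphOfContinuousOpen
    T.continuous_proj T.str.isLocalHomeomorph_proj.isOpenMap
  have he : ∀ x, T.proj (e.symm x) = x := fun x => e.apply_symm_apply x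
  IsTerminal.ofUniqueHom (fun W =>
    { toFun w := e.symm (W.proj w)
      continuous_toFun := e.symm.continuous.comp W.continuous_proj
      proj_toFun w := he _
      map_act g w h := by
        apply hT.1
        rw [he]
        simp })
    (fun W m => by
      apply hom_ext
      intro w
      apply hT.1
      exact (Hom.proj_toFun m w).trans (he _).symm)

/-- The fibre product of sheaves. -/
def fibProd {A B C : Sh X} (f : A ⟶ C) (g : B ⟶ C) : Sh X where
  carrier := {p : A × B // Hom.toFun f p.1 = Hom.toFun g p.2}
  str :=
    { proj := fun p => A.proj p.1.1
      isLocalHomeomorph_proj := A.str.isLocalHomeomorph_proj.comp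
        (isLocalHomeomorph_pullback (Hom.continuous_toFun f) (Hom.isLocalHomeomorph g))
      act := fun k p e =>
        have e' : X.src k = B.proj p.1.2 := by
          rw [← Hom.proj_toFun g, ← p.2, Hom.proj_toFun f, e]
        ⟨(A.act k p.1.1 e, B.act k p.1.2 e'), by
          simp only [Hom.map_act]
          exact act_congr _ rfl p.2 _ _⟩
      continuous_act := by
        refine Continuous.subtype_mk (.prodMk ?_ ?_) _
        · exact A.continuous_act' (by fun_prop) (by fun_prop) _
        · exact B.continuous_act' (by fun_prop) (by fun_prop) _
      proj_act := fun _ _ _ => A.str.proj_act _ _ _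
      act_one := by
        rintro ⟨⟨a, b⟩, h⟩
        apply Subtype.ext
        refine Prod.ext (A.str.act_one a) ?_
        refine (act_congr _ (congrArg X.one ?_) rfl _ (X.src_one _)).trans (B.str.act_one b)
        rw [← Hom.proj_toFun g, ← Hom.proj_toFun f, h]
      act_comp := by
        rintro k l ⟨⟨a, b⟩, h⟩ e e'
        apply Subtype.ext
        exact Prod.ext (A.str.act_comp _ _ _ _ _) (B.str.act_comp _ _ _ _ _) }

def fibProdFst {A B C : Sh X} (f : A ⟶ C) (g : B ⟶ C) : fibProd f g ⟶ A where
  toFun p := p.1.1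
  continuous_toFun := by
    exact continuous_fst.comp continuous_subtype_val
  proj_toFun _ := rfl
  map_act _ _ _ := rfl

def fibProdSnd {A B C : Sh X} (f : A ⟶ C) (g : B ⟶ C) : fibProd f g ⟶ B where
  toFun p := p.1.2
  continuous_toFun := by
    exact continuous_snd.comp continuous_subtype_val
  proj_toFun p := by
    change B.proj p.1.2 = A.proj p.1.1
    rw [← Hom.proj_toFun g, ← p.2, Hom.proj_toFun f]
  map_act _ _ _ := rfl

lemma fibProd_w {A B C : Sh X} (f : A ⟶ C) (g : B ⟶ C) :
    fibProdFst f g ≫ f = fibProdSnd f g ≫ g := by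
  apply hom_ext
  intro p
  exact p.2

/-- A commutative square of sheaves that is a pullback on underlying sets is a pullback. -/
lemma isPullback_of_bijective {P A B C : Sh X} {p : P ⟶ A} {q : P ⟶ B} {f : A ⟶ C} {g : B ⟶ C}
    (w : p ≫ f = q ≫ g)
    (hinj : ∀ z z' : P, Hom.toFun p z = Hom.toFun p z' → Hom.toFun q z = Hom.toFun q z' → z = z')
    (hsurj : ∀ (a : A) (b : B), Hom.toFun f a = Hom.toFun g b →
      ∃ z : P, Hom.toFun p z = a ∧ Hom.toFun q z = b) :
    IsPullback p q f g := by
  refine ⟨⟨w⟩, ⟨?_⟩⟩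
  let c : P → fibProd f g := fun z => ⟨(Hom.toFun p z, Hom.toFun q z),
    congrArg (fun m : P ⟶ C => Hom.toFun m z) w⟩
  have hc : Continuous c :=
    Continuous.subtype_mk (.prodMk (Hom.continuous_toFun p) (Hom.continuous_toFun q)) _
  let φ : P ⟶ fibProd f g :=
    { toFun := c
      continuous_toFun := hc
      proj_toFun := Hom.proj_toFun p
      map_act k z e := by
        apply Subtype.ext
        exact Prod.ext (Hom.map_act p _ _ _) (Hom.map_act q _ _ _) }
  have hbij : Function.Bijective c := by
    constructor
    · intro z z' h
      exact hinj z z' (congrArg (fun t => t.1.1) h) (congrArg (fun t => t.1.2) h)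
    · rintro ⟨⟨a, b⟩, h⟩
      obtain ⟨z, rfl, rfl⟩ := hsurj a b h
      exact ⟨z, rfl⟩
  let e : P ≃ₜ fibProd f g := (Equiv.ofBijective c hbij).toHomeomorphOfContinuousOpen hc
    (Hom.isLocalHomeomorph φ).isOpenMap
  have he : ∀ y, c (e.symm y) = y := fun y => e.apply_symm_apply y
  have he1 : ∀ y, Hom.toFun p (e.symm y) = y.1.1 := fun y => congrArg (fun t => t.1.1) (he y)
  have he2 : ∀ y, Hom.toFun q (e.symm y) = y.1.2 := fun y => congrArg (fun t => t.1.2) (he y)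
  let mk : ∀ s : PullbackCone f g, s.pt → fibProd f g := fun s z =>
    ⟨(Hom.toFun s.fst z, Hom.toFun s.snd z),
      congrArg (fun m : s.pt ⟶ C => Hom.toFun m z) s.condition⟩
  refine PullbackCone.IsLimit.mk w
    (fun s =>
      { toFun z := e.symm (mk s z)
        continuous_toFun := e.symm.continuous.comp (Continuous.subtype_mk
          (.prodMk (Hom.continuous_toFun s.fst) (Hom.continuous_toFun s.snd)) _)
        proj_toFun z := by
          exact (Hom.proj_toFun p _).symm.trans
            ((congrArg A.proj (he1 _)).trans (Hom.proj_toFun s.fst z))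
        map_act k z h := by
          apply hinj
          · refine (he1 _).trans ((Hom.map_act s.fst _ _ _).trans
              (Eq.trans ?_ (Hom.map_act p _ _ _).symm))
            exact act_congr _ rfl (he1 (mk s z)).symm _ _
          · refine (he2 _).trans ((Hom.map_act s.snd _ _ _).trans
              (Eq.trans ?_ (Hom.map_act q _ _ _).symm))
            exact act_congr _ rfl (he2 (mk s z)).symm _ _ }) ?_ ?_ ?_
  · intro s
    apply hom_ext
    intro z
    exact he1 _
  · intro s
    apply hom_ext
    intro z
    exact he2 _
  · intro s m h1 h2
    apply hom_ext
    intro z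
    apply hinj
    · exact (congrArg (fun m : s.pt ⟶ A => Hom.toFun m z) h1).trans (he1 (mk s z)).symm
    · exact (congrArg (fun m : s.pt ⟶ B => Hom.toFun m z) h2).trans (he2 (mk s z)).symm

lemma isPullback_fibProd {A B C : Sh X} (f : A ⟶ C) (g : B ⟶ C) :
    IsPullback (fibProdFst f g) (fibProdSnd f g) f g :=
  isPullback_of_bijective (fibProd_w f g)
    (fun _ _ h h' => Subtype.ext (Prod.ext h h')) (fun a b h => ⟨⟨(a, b), h⟩, rfl, rfl⟩)

instance : HasTerminal (Sh X) :=
  (isTerminalOfBijective (terminal X) Function.bijective_id).hasTerminal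

instance : HasPullbacks (Sh X) :=
  have : ∀ {A B C : Sh X} {f : A ⟶ C} {g : B ⟶ C}, HasLimit (cospan f g) :=
    fun {_ _ _ f g} => (isPullback_fibProd f g).hasPullback
  hasPullbacks_of_hasLimit_cospan _

/-- Inverse image functors are left exact. -/
instance preservesFiniteLimits_inverseImage (Φ : ContFunctor X Y) :
    PreservesFiniteLimits (inverseImage Φ) := by
  have h1 : PreservesLimit (Functor.empty.{0} (Sh Y)) (inverseImage Φ) := by
    refine preservesLimit_of_preserves_limit_cone
      (isTerminalOfBijective (terminal Y) Function.bijective_id) ?_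
    refine (isLimitMapConeEmptyConeEquiv _ _).symm (isTerminalOfBijective _ ⟨?_, ?_⟩)
    · rintro ⟨⟨x, y⟩, h⟩ ⟨⟨x', y'⟩, h'⟩ e
      have e : x = x' := e
      have h : Φ.obj x = y := h
      have h' : Φ.obj x' = y' := h'
      subst e h h'
      rfl
    · intro x
      exact ⟨⟨(x, Φ.obj x), rfl⟩, rfl⟩
  have h2 : PreservesLimitsOfShape (Discrete PEmpty.{1}) (inverseImage Φ) :=
    preservesLimitsOfShape_pempty_of_preservesTerminal _
  have h3 : PreservesLimitsOfShape WalkingCospan (inverseImage Φ) := by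
    have key : ∀ {A B C : Sh Y} (f : A ⟶ C) (g : B ⟶ C),
        PreservesLimit (cospan f g) (inverseImage Φ) := by
      intro A B C f g
      refine preservesLimit_of_preserves_limit_cone (isPullback_fibProd f g).isLimit
        ((isLimitMapConePullbackConeEquiv _ (fibProd_w f g)).symm
          (isPullback_of_bijective (by rw [← Functor.map_comp, ← Functor.map_comp, fibProd_w])
            ?_ ?_).isLimit)
      · rintro ⟨⟨x, z⟩, h⟩ ⟨⟨x', z'⟩, h'⟩ e e'
        apply Subtype.ext
        refine Prod.ext (congrArg (fun t => t.1.1) e) (Subtype.ext (Prod.ext ?_ ?_))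
        · exact congrArg (fun t => t.1.2) e
        · exact congrArg (fun t => t.1.2) e'
      · rintro ⟨⟨x, a⟩, h⟩ ⟨⟨x', b⟩, h'⟩ e
        have e1 : x = x' := congrArg (fun t => t.1.1) e
        subst e1
        exact ⟨⟨(x, ⟨(a, b), congrArg (fun t => t.1.2) e⟩), h⟩, rfl, rfl⟩
    exact ⟨fun {K} => preservesLimit_of_iso_diagram _ (diagramIsoCospan K).symm⟩
  exact preservesFiniteLimits_of_preservesTerminal_and_pullbacks _

end LeftExact
section RightAdjoint

lemma map_nhds (A B : Sh X) (f : A ⟶ B) (a : A) :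
    (𝓝 a).map (Hom.toFun f) = 𝓝 (Hom.toFun f a) :=
  (Hom.isLocalHomeomorph f).map_nhds_eq a

/-- Continuity of a map out of a sheaf can be checked on a jointly surjective family. -/
lemma continuous_of_cover {B : Sh X} {S : Type*} [TopologicalSpace S] {k : B → S}
    (h : ∀ b : B, ∃ (A : Sh X) (f : A ⟶ B) (a : A), Hom.toFun f a = b ∧
      Continuous (fun a => k (Hom.toFun f a))) : Continuous k := by
  rw [continuous_iff_continuousAt]
  intro b
  obtain ⟨A, f, a, rfl, hc⟩ := h b
  rw [ContinuousAt, ← map_nhds A B f a, Filter.tendsto_map'_iff]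
  exact hc.continuousAt

/-- The subsheaf on an open invariant subset. -/
def sub (W : Sh X) (T : Set W) (hT : IsOpen T)
    (hact : ∀ g w e, w ∈ T → W.act g w e ∈ T) : Sh X where
  carrier := T
  str :=
    { proj := fun w => W.proj w.1
      isLocalHomeomorph_proj :=
        W.str.isLocalHomeomorph_proj.comp hT.isOpenEmbedding_subtypeVal.isLocalHomeomorph
      act := fun g w e => ⟨W.act g w.1 e, hact g w.1 e w.2⟩
      continuous_act :=
        Continuous.subtype_mk (W.continuous_act' (by fun_prop) (by fun_prop) _) _
      proj_act := fun g w e => W.str.proj_act _ _ _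
      act_one := fun w => Subtype.ext (W.str.act_one _)
      act_comp := fun g h w e e' => Subtype.ext (W.str.act_comp _ _ _ _ _) }

def subι (W : Sh X) (T : Set W) (hT : IsOpen T)
    (hact : ∀ g w e, w ∈ T → W.act g w e ∈ T) : sub W T hT hact ⟶ W where
  toFun w := w.1
  continuous_toFun := continuous_subtype_val
  proj_toFun _ := rfl
  map_act _ _ _ := rfl

/-- Transport of a sheaf along a bijection of the underlying set. -/
def transport (W : Sh X) {S : Type u} (j : S ≃ W) : Sh X :=
  letI : TopologicalSpace S := TopologicalSpace.induced j inferInstance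
  have hj : Topology.IsInducing j := ⟨rfl⟩
  have hjc : Continuous j := hj.continuous
  { carrier := S
    str :=
      { proj := fun w => W.proj (j w)
        isLocalHomeomorph_proj := W.str.isLocalHomeomorph_proj.comp
          (j.toHomeomorphOfIsInducing hj).isLocalHomeomorph
        act := fun g w e => j.symm (W.act g (j w) e)
        continuous_act := by
          rw [hj.continuous_iff]
          simp only [Function.comp_def, Equiv.apply_symm_apply]
          exact W.continuous_act' (by fun_prop) (by fun_prop) _
        proj_act := fun g w e => by simp
        act_one := fun w => by simp
        act_comp := fun g h w e e' => by
          apply congrArg j.symm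
          exact (act_congr _ rfl (by simp) _ _).trans (W.str.act_comp g h _ e e') } }

def transportHom (W : Sh X) {S : Type u} (j : S ≃ W) : transport W j ⟶ W where
  toFun := j
  continuous_toFun := continuous_induced_dom
  proj_toFun _ := rfl
  map_act _ _ _ := by
    exact j.apply_symm_apply _

/-- Every point of a sheaf lies in the image of a sheaf whose underlying set is a subset of a fixed
set. -/
lemma exists_small (W : Sh X) (w : W) :
    ∃ (S : Set (List (X.Arr × X.Obj))) (_ : TopologicalSpace S) (str : SheafStr X S)
      (f : Sh.mk S str ⟶ W) (b : S), Hom.toFun f b = w := by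
  classical
  choose O hO hmem hinj using W.str.isLocalHomeomorph_proj.isLocallyInjective
  let Q : W → X.Arr × X.Obj → W → Prop := fun v gy v' =>
    ∃ e : X.src gy.1 = W.proj v, v' ∈ O (W.act gy.1 v e) ∧ W.proj v' = gy.2
  let step : W → X.Arr × X.Obj → W := fun v gy =>
    if h : ∃ v', Q v gy v' then h.choose else v
  have hstep : ∀ v gy v', Q v gy v' → step v gy = v' := by
    intro v gy v' h
    have h' : ∃ v', Q v gy v' := ⟨v', h⟩
    have e1 : step v gy = h'.choose := dif_pos h'
    obtain ⟨e, h1, h2⟩ := h'.choose_spec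
    obtain ⟨e, h3, h4⟩ := h
    rw [e1]
    exact hinj _ h1 h3 (h2.trans h4.symm)
  let ev : List (X.Arr × X.Obj) → W := fun l => l.foldl step w
  let T : Set W := Set.range ev
  have hTs : ∀ v ∈ T, ∀ gy, step v gy ∈ T := by
    rintro _ ⟨l, rfl⟩ gy
    exact ⟨l ++ [gy], by simp [ev]⟩
  have hT : IsOpen T := by
    rw [isOpen_iff_forall_mem_open]
    intro v hv
    refine ⟨O v, ?_, hO v, hmem v⟩
    intro v' hv'
    have := hTs v hv (X.one (W.proj v), W.proj v')
    rwa [hstep v _ v' ⟨X.src_one _, by simpa using hv', rfl⟩] at this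
  have hact : ∀ g v e, v ∈ T → W.act g v e ∈ T := by
    intro g v e hv
    have := hTs v hv (g, X.tgt g)
    rwa [hstep v _ (W.act g v e) ⟨e, hmem _, by simp⟩] at this
  let A := sub W T hT hact
  have hs : ∀ a : A, ∃ l, ev l = a.1 := fun a => a.2
  choose c hc using hs
  have hcinj : Function.Injective c := by
    intro a a' h
    apply Subtype.ext
    rw [← hc, ← hc, h]
  let j := (Equiv.ofInjective c hcinj).symm
  refine ⟨Set.range c, _, (transport A j).str, transportHom A j ≫ subι W T hT hact,
    j.symm ⟨w, ⟨[], rfl⟩⟩, ?_⟩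
  exact congrArg Subtype.val (j.apply_symm_apply _)

/-- The sheaf obtained by gluing a small family of sheaves along an open invariant equivalence
relation on its disjoint union. -/
noncomputable def glue {ι : Type u} (W : ι → Sh X) (r : Setoid (Σ i, W i))
    (hproj : ∀ p q, r p q → (W p.1).proj p.2 = (W q.1).proj q.2)
    (hact : ∀ p q g e e', r p q → r ⟨p.1, (W p.1).act g p.2 e⟩ ⟨q.1, (W q.1).act g q.2 e'⟩)
    (hopen : ∀ i (U : Set (W i)), IsOpen U → IsOpen {q | ∃ w ∈ U, r ⟨i, w⟩ q}) : Sh X :=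
  let pr : Quotient r → X.Obj := Quotient.lift (fun p => (W p.1).proj p.2) hproj
  let ac : (g : X.Arr) → (q : Quotient r) → X.src g = pr q → Quotient r := fun g q e =>
    ⟦⟨q.out.1, (W q.out.1).act g q.out.2 (e.trans (congrArg pr q.out_eq.symm))⟩⟧
  have hac : ∀ g i w e, ac g ⟦⟨i, w⟩⟧ e = ⟦⟨i, (W i).act g w e⟩⟧ := fun g i w e =>
    Quotient.sound (hact _ _ _ _ _ (Quotient.mk_out (s := r) ⟨i, w⟩))
  let c : ∀ i, W i → Quotient r := fun i w => ⟦⟨i, w⟩⟧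
  have hc : ∀ i, Continuous (c i) := fun i => continuous_quot_mk.comp continuous_sigmaMk
  have hpr : Continuous pr := by
    refine Continuous.quotient_lift ?_ _
    exact continuous_sigma fun i => (W i).continuous_proj
  have hco : ∀ i, IsOpenMap (c i) := by
    intro i U hU
    refine isOpen_coinduced.2 ?_
    convert hopen i U hU using 1
    ext q
    constructor
    · rintro ⟨w, hw, h⟩
      exact ⟨w, hw, Quotient.exact h⟩
    · rintro ⟨w, hw, h⟩
      exact ⟨w, hw, Quotient.sound h⟩
  have hprL : IsLocalHomeomorph pr := by
    refine isLocalHomeomorph_of hpr ?_ ?_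
    · rw [isOpenMap_iff_nhds_le]
      intro q
      induction q using Quotient.inductionOn with
      | _ p =>
      obtain ⟨i, w⟩ := p
      refine le_trans ((W i).str.isLocalHomeomorph_proj.map_nhds_eq w).ge ?_
      have : Filter.map (c i) (𝓝 w) ≤ 𝓝 (c i w) := (hc i).continuousAt
      exact (Filter.map_mono (m := pr) this)
    · intro q
      induction q using Quotient.inductionOn with
      | _ p =>
      obtain ⟨i, w⟩ := p
      obtain ⟨U, hU, hw, hinj⟩ := (W i).str.isLocalHomeomorph_proj.isLocallyInjective w
      refine ⟨c i '' U, hco i U hU, ⟨w, hw, rfl⟩, ?_⟩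
      rintro _ ⟨w1, h1, rfl⟩ _ ⟨w2, h2, rfl⟩ h
      exact congrArg (c i) (hinj h1 h2 h)
  { carrier := Quotient r
    str :=
      { proj := pr
        isLocalHomeomorph_proj := hprL
        act := ac
        continuous_act := by
          rw [continuous_iff_continuousAt]
          rintro ⟨⟨g, q⟩, e⟩
          induction q using Quotient.inductionOn with
          | _ p =>
          obtain ⟨i, w⟩ := p
          let m : {p : X.Arr × W i // X.src p.1 = (W i).proj p.2} →
            {p : X.Arr × Quotient r // X.src p.1 = pr p.2} := fun p => ⟨(p.1.1, c i p.1.2), p.2⟩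
          have hmc : Continuous m := Continuous.subtype_mk
            (.prodMk (by fun_prop) ((hc i).comp (by fun_prop))) _
          have hm : IsLocalHomeomorph m := IsLocalHomeomorph.of_comp
            (g := fun p : {p : X.Arr × Quotient r // X.src p.1 = pr p.2} => p.1.1)
            (isLocalHomeomorph_pullback X.continuous_src (W i).str.isLocalHomeomorph_proj)
            (isLocalHomeomorph_pullback X.continuous_src hprL) hmc
          have := hm.map_nhds_eq ⟨(g, w), e⟩
          change Filter.Tendsto _ (𝓝 (m ⟨(g, w), e⟩)) _
          rw [← this, Filter.tendsto_map'_iff]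
          refine ContinuousAt.congr (f := fun p => c i ((W i).act p.1.1 p.1.2 p.2)) ?_ ?_
          · exact ((hc i).comp (W i).str.continuous_act).continuousAt
          · exact Filter.Eventually.of_forall fun p => (hac _ _ _ _).symm
        proj_act := by
          intro g q e
          induction q using Quotient.inductionOn with
          | _ p =>
          exact (congrArg pr (hac g p.1 p.2 e)).trans ((W p.1).str.proj_act _ _ _)
        act_one := by
          intro q
          induction q using Quotient.inductionOn with
          | _ p => exact (hac _ _ _ _).trans (congrArg (c p.1) ((W p.1).str.act_one _))
        act_comp := by
          intro g h q e e'
          induction q using Quotient.inductionOn with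
          | _ p =>
          have h1 := hac g p.1 p.2 e
          simp only [h1]
          exact (hac _ _ _ _).trans ((congrArg (c p.1) ((W p.1).str.act_comp _ _ _ _ _)).trans
            (hac _ _ _ _).symm) } }

variable (Φ : ContFunctor X Y) (V : Sh X)

/-- A small sheaf `W` on `Y` together with a morphism `Sh(Φ)^* W ⟶ V`. -/
structure DirIdx : Type u where
  S : Set (List (Y.Arr × Y.Obj))
  [top : TopologicalSpace S]
  str : SheafStr Y S
  map : (inverseImage Φ).obj ⟨S, str⟩ ⟶ V

attribute [instance] DirIdx.top

variable {Φ V}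

abbrev DirIdx.sheaf (i : DirIdx Φ V) : Sh Y := ⟨i.S, i.str⟩

/-- Two points are identified if they have a common preimage in a sheaf over both. -/
def dirRel (p q : Σ i : DirIdx Φ V, i.sheaf) : Prop :=
  ∃ (P : Sh Y) (f : P ⟶ p.1.sheaf) (g : P ⟶ q.1.sheaf) (z : P),
    (inverseImage Φ).map f ≫ p.1.map = (inverseImage Φ).map g ≫ q.1.map ∧
    Hom.toFun f z = p.2 ∧ Hom.toFun g z = q.2

lemma dirRel_trans {p q r : Σ i : DirIdx Φ V, i.sheaf} (h : dirRel p q) (h' : dirRel q r) :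
    dirRel p r := by
  obtain ⟨P, f, g, z, e, e1, e2⟩ := h
  obtain ⟨P', f', g', z', e', e1', e2'⟩ := h'
  refine ⟨fibProd g f', fibProdFst g f' ≫ f, fibProdSnd g f' ≫ g', ⟨(z, z'), e2.trans e1'.symm⟩,
    ?_, e1, e2'⟩
  rw [Functor.map_comp, Functor.map_comp, Category.assoc, Category.assoc, e, ← e',
    ← Category.assoc, ← Category.assoc, ← Functor.map_comp, ← Functor.map_comp, fibProd_w]

variable (Φ V) in
def dirSetoid : Setoid (Σ i : DirIdx Φ V, i.sheaf) where
  r := dirRel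
  iseqv :=
    ⟨fun p => ⟨p.1.sheaf, 𝟙 _, 𝟙 _, p.2, rfl, rfl, rfl⟩,
     fun ⟨P, f, g, z, e, e1, e2⟩ => ⟨P, g, f, z, e.symm, e2, e1⟩,
     dirRel_trans⟩

variable (Φ V) in
/-- The direct image of `V` along `Φ`. -/
noncomputable def dirObj : Sh Y :=
  glue (fun i : DirIdx Φ V => i.sheaf) (dirSetoid Φ V)
    (by
      rintro p q ⟨P, f, g, z, -, e1, e2⟩
      rw [← e1, ← e2, Hom.proj_toFun f, Hom.proj_toFun g])
    (by
      rintro p q k e e' ⟨P, f, g, z, h, e1, e2⟩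
      have hz : Y.src k = P.proj z := by rw [e, ← e1, Hom.proj_toFun f]
      exact ⟨P, f, g, P.act k z hz, h, (Hom.map_act f _ _ _).trans (act_congr _ rfl e1 _ _),
        (Hom.map_act g _ _ _).trans (act_congr _ rfl e2 _ _)⟩)
    (by
      intro i U hU
      rw [isOpen_iff_forall_mem_open]
      rintro ⟨j, w'⟩ ⟨w, hw, ⟨P, f, g, z, h, e1, e2⟩⟩
      refine ⟨Sigma.mk j '' (Hom.toFun g '' (Hom.toFun f ⁻¹' U)), ?_, ?_, ?_⟩
      · rintro _ ⟨_, ⟨z', hz', rfl⟩, rfl⟩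
        exact ⟨_, hz', P, f, g, z', h, rfl, rfl⟩
      · exact isOpenMap_sigmaMk _ ((Hom.isLocalHomeomorph g).isOpenMap _
          (hU.preimage (Hom.continuous_toFun f)))
      · refine ⟨w', ⟨z, ?_, e2⟩, rfl⟩
        change Hom.toFun f z ∈ U
        rw [e1]
        exact hw)

/-- The canonical map from a member of the family to the direct image. -/
noncomputable def dirι (i : DirIdx Φ V) : i.sheaf ⟶ dirObj Φ V where
  toFun w := Quotient.mk (dirSetoid Φ V) ⟨i, w⟩
  continuous_toFun := continuous_quot_mk.comp continuous_sigmaMk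
  proj_toFun _ := rfl
  map_act g w e :=
    (Quotient.sound (by
      obtain ⟨P, f, k, z, h, e1, e2⟩ := Quotient.mk_out (s := dirSetoid Φ V) ⟨i, w⟩
      have hz : Y.src g = P.proj z :=
        e.trans ((congrArg i.sheaf.proj e2).symm.trans (Hom.proj_toFun k z))
      exact ⟨P, f, k, P.act g z hz, h, (Hom.map_act f _ _ _).trans (act_congr _ rfl e1 _ _),
        (Hom.map_act k _ _ _).trans (act_congr _ rfl e2 _ _)⟩)).symm

lemma dirι_surj (q : dirObj Φ V) : ∃ (i : DirIdx Φ V) (w : i.sheaf), Hom.toFun (dirι i) w = q := by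
  obtain ⟨⟨i, w⟩, h⟩ := Quotient.exists_rep (s := dirSetoid Φ V) q
  exact ⟨i, w, h⟩

lemma dirι_eq_iff {i j : DirIdx Φ V} {w : i.sheaf} {w' : j.sheaf} :
    Hom.toFun (dirι i) w = Hom.toFun (dirι j) w' ↔ dirRel ⟨i, w⟩ ⟨j, w'⟩ :=
  ⟨fun h => Quotient.exact (s := dirSetoid Φ V) h, fun h => Quotient.sound (s := dirSetoid Φ V) h⟩

lemma counit_wd {i j : DirIdx Φ V} {w : i.sheaf} {w' : j.sheaf}
    (h : Hom.toFun (dirι i) w = Hom.toFun (dirι j) w') (x : X.Obj) (e : Φ.obj x = i.sheaf.proj w)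
    (e' : Φ.obj x = j.sheaf.proj w') :
    Hom.toFun i.map ⟨(x, w), e⟩ = Hom.toFun j.map ⟨(x, w'), e'⟩ := by
  have h0 : ∃ (P : Sh Y) (f : P ⟶ i.sheaf) (g : P ⟶ j.sheaf) (z : P),
      (inverseImage Φ).map f ≫ i.map = (inverseImage Φ).map g ≫ j.map ∧
      Hom.toFun f z = w ∧ Hom.toFun g z = w' := dirι_eq_iff.1 h
  obtain ⟨P, f, g, z, hP, rfl, rfl⟩ := h0
  have hz : Φ.obj x = P.proj z := e.trans (Hom.proj_toFun f z)
  exact congrArg (fun m : (inverseImage Φ).obj P ⟶ V => Hom.toFun m ⟨(x, z), hz⟩) hP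

variable (Φ V) in
/-- The counit `Sh(Φ)^* Sh(Φ)_* V ⟶ V`. -/
noncomputable def dirCounit : (inverseImage Φ).obj (dirObj Φ V) ⟶ V :=
  let idx : dirObj Φ V → DirIdx Φ V := fun q => (dirι_surj q).choose
  let pt : ∀ q : dirObj Φ V, (idx q).sheaf := fun q => (dirι_surj q).choose_spec.choose
  have hpt : ∀ q, Hom.toFun (dirι (idx q)) (pt q) = q := fun q =>
    (dirι_surj q).choose_spec.choose_spec
  have hpr : ∀ q, (idx q).sheaf.proj (pt q) = (dirObj Φ V).proj q := fun q =>
    (Hom.proj_toFun (dirι (idx q)) (pt q)).symm.trans (congrArg _ (hpt q))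
  let F : (inverseImage Φ).obj (dirObj Φ V) → V := fun p =>
    Hom.toFun (idx p.1.2).map ⟨(p.1.1, pt p.1.2), p.2.trans (hpr _).symm⟩
  have hF : ∀ (i : DirIdx Φ V) (p : (inverseImage Φ).obj i.sheaf),
      F (Hom.toFun ((inverseImage Φ).map (dirι i)) p) = Hom.toFun i.map p := fun i p =>
    counit_wd (hpt _) _ _ p.2
  have hsurj : ∀ p : (inverseImage Φ).obj (dirObj Φ V), ∃ (i : DirIdx Φ V)
      (p' : (inverseImage Φ).obj i.sheaf), Hom.toFun ((inverseImage Φ).map (dirι i)) p' = p := by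
    rintro ⟨⟨x, q⟩, e⟩
    obtain ⟨i, w, rfl⟩ := dirι_surj q
    exact ⟨i, ⟨(x, w), e⟩, rfl⟩
  { toFun := F
    continuous_toFun := by
      refine continuous_of_cover fun p => ?_
      obtain ⟨i, p', rfl⟩ := hsurj p
      refine ⟨_, (inverseImage Φ).map (dirι i), p', rfl, ?_⟩
      simp only [hF]
      exact Hom.continuous_toFun i.map
    proj_toFun := by
      intro p
      obtain ⟨i, p', rfl⟩ := hsurj p
      rw [hF, Hom.proj_toFun, Hom.proj_toFun]
    map_act := by
      intro g p e
      obtain ⟨i, p', rfl⟩ := hsurj p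
      have e' : X.src g = ((inverseImage Φ).obj i.sheaf).proj p' := e
      refine (congrArg F (Hom.map_act ((inverseImage Φ).map (dirι i)) g p' e').symm).trans ?_
      rw [hF, Hom.map_act]
      exact act_congr _ rfl (hF _ _).symm _ _ }

lemma dirCounit_ι (i : DirIdx Φ V) :
    (inverseImage Φ).map (dirι i) ≫ dirCounit Φ V = i.map := by
  apply hom_ext
  intro p
  have h := (dirι_surj (Hom.toFun (dirι i) p.1.2)).choose_spec.choose_spec
  exact counit_wd h _ _ p.2

lemma dir_hom_unique {W : Sh Y} (h h' : W ⟶ dirObj Φ V)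
    (e : (inverseImage Φ).map h ≫ dirCounit Φ V = (inverseImage Φ).map h' ≫ dirCounit Φ V) :
    h = h' := by
  apply hom_ext
  intro w
  obtain ⟨i, a, ha⟩ := dirι_surj (Hom.toFun h w)
  obtain ⟨j, b, hb⟩ := dirι_surj (Hom.toFun h' w)
  rw [← ha, ← hb, dirι_eq_iff]
  refine ⟨fibProd (fibProdSnd (dirι i) h) (fibProdSnd (dirι j) h'),
    fibProdFst _ _ ≫ fibProdFst _ _, fibProdSnd _ _ ≫ fibProdFst _ _,
    ⟨(⟨(a, w), ha⟩, ⟨(b, w), hb⟩), rfl⟩, ?_, rfl, rfl⟩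
  have e1 : ∀ {i : DirIdx Φ V} {P : Sh Y} (k : P ⟶ i.sheaf),
      (inverseImage Φ).map k ≫ i.map = (inverseImage Φ).map (k ≫ dirι i) ≫ dirCounit Φ V := by
    intro i P k
    rw [Functor.map_comp, Category.assoc, dirCounit_ι]
  refine (e1 _).trans (Eq.trans ?_ (e1 _).symm)
  rw [Category.assoc, Category.assoc, fibProd_w, fibProd_w, ← Category.assoc, fibProd_w,
    Functor.map_comp, Category.assoc, e, ← Category.assoc, ← Functor.map_comp, Category.assoc]

lemma dir_hom_exists {W : Sh Y} (α : (inverseImage Φ).obj W ⟶ V) :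
    ∃ h : W ⟶ dirObj Φ V, (inverseImage Φ).map h ≫ dirCounit Φ V = α := by
  have key : ∀ w : W, ∃ (i : DirIdx Φ V) (f : i.sheaf ⟶ W) (b : i.sheaf),
      (inverseImage Φ).map f ≫ α = i.map ∧ Hom.toFun f b = w := by
    intro w
    obtain ⟨S, t, str, f, b, h⟩ := exists_small W w
    exact ⟨⟨S, str, (inverseImage Φ).map f ≫ α⟩, f, b, rfl, h⟩
  choose idx f b hf hb using key
  let H : W → dirObj Φ V := fun w => Hom.toFun (dirι (idx w)) (b w)
  have hH : ∀ (i : DirIdx Φ V) (k : i.sheaf ⟶ W) (hk : (inverseImage Φ).map k ≫ α = i.map)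
      (c : i.sheaf), H (Hom.toFun k c) = Hom.toFun (dirι i) c := by
    intro i k hk c
    refine dirι_eq_iff.2 ⟨fibProd (f (Hom.toFun k c)) k, fibProdFst _ _, fibProdSnd _ _,
      ⟨(b _, c), hb _⟩, ?_, rfl, rfl⟩
    rw [← hf, ← hk, ← Category.assoc, ← Functor.map_comp, fibProd_w, Functor.map_comp,
      Category.assoc]
  let h : W ⟶ dirObj Φ V :=
    { toFun := H
      continuous_toFun := by
        refine continuous_of_cover fun w => ⟨_, f w, b w, hb w, ?_⟩
        simp only [hH _ _ (hf w)]
        exact Hom.continuous_toFun (dirι (idx w))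
      proj_toFun := by
        intro w
        exact (Hom.proj_toFun (dirι (idx w)) _).trans ((Hom.proj_toFun (f w) _).symm.trans
          (congrArg _ (hb w)))
      map_act := by
        intro g w e
        have e' : Y.src g = (idx w).sheaf.proj (b w) := by
          rw [e, ← Hom.proj_toFun (f w), hb]
        have h1 : W.act g w e = Hom.toFun (f w) ((idx w).sheaf.act g (b w) e') := by
          rw [Hom.map_act]
          exact act_congr _ rfl (hb w).symm _ _
        rw [h1, hH _ _ (hf w), Hom.map_act] }
  refine ⟨h, ?_⟩
  apply hom_ext
  rintro ⟨⟨x, w⟩, e⟩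
  have e' : Φ.obj x = (idx w).sheaf.proj (b w) := by
    refine Eq.trans e ?_
    rw [← Hom.proj_toFun (f w), hb]
  have e1 := congrArg (fun m : (inverseImage Φ).obj (idx w).sheaf ⟶ V =>
    Hom.toFun m ⟨(x, b w), e'⟩) (dirCounit_ι (idx w))
  have e2 := congrArg (fun m : (inverseImage Φ).obj (idx w).sheaf ⟶ V =>
    Hom.toFun m ⟨(x, b w), e'⟩) (hf w)
  refine Eq.trans (e1.trans e2.symm) ?_
  change Hom.toFun α ⟨(x, Hom.toFun (f w) (b w)), _⟩ = _
  simp only [hb]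

/-- Inverse image functors have right adjoints. -/
instance isLeftAdjoint_inverseImage (Φ : ContFunctor X Y) : (inverseImage Φ).IsLeftAdjoint := by
  have : ∀ V, HasTerminal (CostructuredArrow (inverseImage Φ) V) := by
    intro V
    refine IsTerminal.hasTerminal (X := CostructuredArrow.mk (dirCounit Φ V))
      (IsTerminal.ofUniqueHom (fun A => CostructuredArrow.homMk (dir_hom_exists A.hom).choose
        (dir_hom_exists A.hom).choose_spec) ?_)
    intro A m
    apply CostructuredArrow.hom_ext
    apply dir_hom_unique
    exact (CostructuredArrow.w m).trans (dir_hom_exists A.hom).choose_spec.symm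
  exact isLeftAdjoint_of_costructuredArrowTerminals _

end RightAdjoint

end Sh
end TopGrpd

/-- A geometric morphism `f : E → F`: an adjunction `f^* ⊣ f_*` with left exact inverse image part
`f^* : F ⥤ E`. -/
structure GeomMorphism (E F : Type (u + 1)) [Category.{u} E] [Category.{u} F] : Type (u + 1) where
  inv : F ⥤ E
  dir : E ⥤ F
  adj : inv ⊣ dir
  leftExact : PreservesFiniteLimits inv

namespace GeomMorphism

variable {E F G H T : Type (u + 1)} [Category.{u} E] [Category.{u} F] [Category.{u} G]
  [Category.{u} H] [Category.{u} T]

/-- The hom-category `Topos(E, F)`: its morphisms `f ⟶ g` are the natural transformations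
`f^* ⟶ g^*`. -/
instance : Category.{u + 1} (GeomMorphism E F) where
  Hom f g := f.inv ⟶ g.inv
  id f := 𝟙 f.inv
  comp α β := @CategoryStruct.comp (F ⥤ E) _ _ _ _ α β
  id_comp α := Category.id_comp (X := (_ : F ⥤ E)) α
  comp_id α := Category.comp_id (X := (_ : F ⥤ E)) α
  assoc α β γ := Category.assoc (W := (_ : F ⥤ E)) α β γ

/-- An isomorphism of inverse images is an isomorphism of geometric morphisms. -/
def isoMk {f g : GeomMorphism E F} (e : f.inv ≅ g.inv) : f ≅ g where
  hom := e.hom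
  inv := e.inv
  hom_inv_id := e.hom_inv_id
  inv_hom_id := e.inv_hom_id

/-- The composite `g ∘ f` of geometric morphisms. -/
def comp (f : GeomMorphism E F) (g : GeomMorphism F G) : GeomMorphism E G where
  inv := g.inv ⋙ f.inv
  dir := f.dir ⋙ g.dir
  adj := g.adj.comp f.adj
  leftExact :=
    have := f.leftExact
    have := g.leftExact
    comp_preservesFiniteLimits _ _

/-- Composition `f ↦ g ∘ f` with a fixed geometric morphism, `Topos(T, F) ⥤ Topos(T, G)`. -/
def postcomp (T : Type (u + 1)) [Category.{u} T] (g : GeomMorphism F G) :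
    GeomMorphism T F ⥤ GeomMorphism T G where
  obj f := f.comp g
  map α := Functor.whiskerLeft g.inv α

/-- For a square of geometric morphisms
```
  E --p--> F
  |        |
  q        f
  v        v
  G --g--> H
```
filled by an isomorphism `θ : f ∘ p ≅ g ∘ q`, the functor from `Topos(T, E)` to the category of
triples `(a : T → F, b : T → G, f ∘ a ≅ g ∘ b)` which sends `h` to `(p ∘ h, q ∘ h, θ ∘ h)`. -/
def toConeFunctor (T : Type (u + 1)) [Category.{u} T] {p : GeomMorphism E F} {q : GeomMorphism E G}
    {f : GeomMorphism F H} {g : GeomMorphism G H} (θ : p.comp f ≅ q.comp g) :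
    GeomMorphism T E ⥤ CategoricalPullback (postcomp T f) (postcomp T g) where
  obj h :=
    { fst := h.comp p
      snd := h.comp q
      iso :=
        { hom := Functor.whiskerRight θ.hom h.inv
          inv := Functor.whiskerRight θ.inv h.inv
          hom_inv_id := by
            apply NatTrans.ext
            funext A
            exact (h.inv.map_comp _ _).symm.trans
              ((congrArg (fun m => h.inv.map (NatTrans.app m A)) θ.hom_inv_id).trans
                (h.inv.map_id _))
          inv_hom_id := by
            apply NatTrans.ext
            funext A
            exact (h.inv.map_comp _ _).symm.trans
              ((congrArg (fun m => h.inv.map (NatTrans.app m A)) θ.inv_hom_id).trans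
                (h.inv.map_id _)) } }
  map {h k} α :=
    { fst := Functor.whiskerLeft p.inv α
      snd := Functor.whiskerLeft q.inv α
      w := by
        apply NatTrans.ext
        funext A
        exact (NatTrans.naturality (F := h.inv) (G := k.inv) α (NatTrans.app θ.hom A)).symm }

end GeomMorphism

/-- Grothendieck topoi: the categories equivalent to the category of sheaves on a small site. -/
def IsGrothendieckTopos (E : Type (u + 1)) [Category.{u} E] : Prop :=
  ∃ (C : Type u) (_ : SmallCategory C) (J : GrothendieckTopology C),
    Nonempty (E ≌ Sheaf J (Type u))

/-- A topos has enough points if the inverse image functors of its points `Set → E` are jointly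
conservative. -/
def ToposHasEnoughPoints (E : Type (u + 1)) [Category.{u} E] : Prop :=
  ∀ ⦃A B : E⦄ (f : A ⟶ B), (∀ p : GeomMorphism (Type u) E, IsIso (p.inv.map f)) → IsIso f

/-- The square of geometric morphisms filled by `θ` is a bi-pullback in the bi-category of
Grothendieck topoi with enough points, geometric morphisms and natural transformations: for every
topos `T` with enough points, geometric morphisms `T → E` are the same as pairs of geometric
morphisms `T → F`, `T → G` with an isomorphism between their composites to `H`. -/
def IsBipullbackWEP {E F G H : Type (u + 1)} [Category.{u} E] [Category.{u} F] [Category.{u} G]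
    [Category.{u} H] {p : GeomMorphism E F} {q : GeomMorphism E G}
    {f : GeomMorphism F H} {g : GeomMorphism G H} (θ : p.comp f ≅ q.comp g) : Prop :=
  ∀ (T : Type (u + 1)) [Category.{u} T], IsGrothendieckTopos T → ToposHasEnoughPoints T →
    (GeomMorphism.toConeFunctor T θ).IsEquivalence

namespace TopGrpd

/-- The geometric morphism `Sh(Φ) : Sh(X) → Sh(Y)` of a continuous functor `Φ : X → Y`. -/
noncomputable def shGeom {X Y : TopGrpd.{u}} (Φ : ContFunctor X Y) :
    GeomMorphism (Sh X) (Sh Y) where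
  inv := Sh.inverseImage Φ
  dir := (Sh.inverseImage Φ).rightAdjoint
  adj := Adjunction.ofIsLeftAdjoint _
  leftExact := inferInstance

/-- The action of `Sh` on hom-categories, as a functor `TopGrpd(X, Y) ⥤ Topos(Sh(X), Sh(Y))`. -/
noncomputable def shFunctor (X Y : TopGrpd.{u}) : ContFunctor X Y ⥤ GeomMorphism (Sh X) (Sh Y) where
  obj Φ := shGeom Φ
  map a := Sh.inverseImageMap a
  map_id Φ := by
    apply NatTrans.ext
    funext W
    apply Sh.hom_ext
    rintro ⟨⟨x, w⟩, h⟩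
    apply Subtype.ext
    exact Prod.ext rfl ((Sh.act_congr W (congrArg Y.one h) rfl _ (Y.src_one _)).trans
      (W.str.act_one w))
  map_comp {Φ Ψ Θ} a b := by
    apply NatTrans.ext
    funext W
    apply Sh.hom_ext
    intro p
    apply Subtype.ext
    exact Prod.ext rfl (W.str.act_comp _ _ _ _ _).symm

/-- The action of `Sh` on hom-categories, `TopGrpd(X, Y) ⥤ Topos^iso(Sh(X), Sh(Y))`, where the
target is the category of geometric morphisms and natural isomorphisms. -/
noncomputable def shIso (X Y : TopGrpd.{u}) :
    ContFunctor X Y ⥤ Core (GeomMorphism (Sh X) (Sh Y)) :=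
  Core.functorToCore (shFunctor X Y)

/-- The canonical isomorphism `Sh(Ψ) ∘ Sh(Φ) ≅ Sh(Ψ ∘ Φ)`. -/
noncomputable def shComp {X Y Z : TopGrpd.{u}} (Φ : ContFunctor X Y) (Ψ : ContFunctor Y Z) :
    (shGeom Φ).comp (shGeom Ψ) ≅ shGeom (Φ.comp Ψ) :=
  GeomMorphism.isoMk (Sh.inverseImageComp Φ Ψ)

/-- A topological space as a topological groupoid with only identity arrows. -/
def disc (S : Type u) [TopologicalSpace S] : TopGrpd.{u} where
  Obj := S
  Arr := S
  src x := x
  tgt x := x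
  one x := x
  inv x := x
  comp x _ _ := x
  src_one _ := rfl
  tgt_one _ := rfl
  src_inv _ := rfl
  tgt_inv _ := rfl
  src_comp _ _ _ := rfl
  tgt_comp _ _ e := e
  one_comp _ := rfl
  comp_one _ := rfl
  assoc _ _ _ _ _ := rfl
  comp_inv _ := rfl
  inv_comp _ := rfl
  continuous_src := continuous_id
  continuous_tgt := continuous_id
  continuous_one := continuous_id
  continuous_inv := continuous_id
  continuous_comp := by fun_prop

/-- A continuous map as a continuous functor. -/
def discMap {S T : Type u} [TopologicalSpace S] [TopologicalSpace T] (f : S → T)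
    (hf : Continuous f) : ContFunctor (disc S) (disc T) where
  obj := f
  arr := f
  src_arr _ := rfl
  tgt_arr _ := rfl
  arr_one _ := rfl
  arr_comp _ _ _ := rfl
  continuous_obj := hf
  continuous_arr := hf

/-- The identity-on-objects functor from the space of objects of `X` to `X`. The geometric morphism
`shGeom (fromObj X)` is `u_X : Sh(X₀) → Sh(X)`. -/
def fromObj (X : TopGrpd.{u}) : ContFunctor (disc X.Obj) X where
  obj x := x
  arr x := X.one x
  src_arr x := X.src_one x
  tgt_arr x := X.tgt_one x
  arr_one _ := rfl
  arr_comp x y e := by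
    have e : x = y := e
    subst e
    exact (X.comp_one (X.one x)).symm.trans (comp_congr rfl (congrArg X.one (X.tgt_one x)) _ _)
  continuous_obj := continuous_id
  continuous_arr := X.continuous_one

/-- The tautological continuous transformation `u ∘ s ⇒ u ∘ t` between functors from the space of
arrows of `X` to `X`, whose component at an arrow `g` is `g : s(g) ⟶ t(g)`. -/
def arrTrans (X : TopGrpd.{u}) :
    ContTrans ((discMap X.src X.continuous_src).comp (fromObj X))
      ((discMap X.tgt X.continuous_tgt).comp (fromObj X)) where
  app g := g
  src_app _ := rfl
  tgt_app _ := rfl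
  naturality g := (X.one_comp g).trans (X.comp_one g).symm
  continuous_app := continuous_id

/-- The canonical isomorphism `Θ : u_X ∘ Sh(s) ≅ u_X ∘ Sh(t)` of geometric morphisms
`Sh(X₁) → Sh(X)`, which is given by `(g, w) ↦ (g, g · w)`. -/
noncomputable def squareIso (X : TopGrpd.{u}) :
    (shGeom (discMap X.src X.continuous_src)).comp (shGeom (fromObj X)) ≅
      (shGeom (discMap X.tgt X.continuous_tgt)).comp (shGeom (fromObj X)) :=
  shComp _ _ ≪≫ ((shIso _ _).map (arrTrans X)).iso ≪≫ (shComp _ _).symm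

/-- Étale complete topological groupoids: open topological groupoids with sober spaces of objects
and arrows for which
```
  Sh(X₁) --Sh(s)--> Sh(X₀)
    |                 |
  Sh(t)              u_X
    v                 v
  Sh(X₀) ---u_X---> Sh(X)
```
is a bi-pullback of topoi with enough points. -/
structure IsEtaleComplete (X : TopGrpd.{u}) : Prop where
  isOpenGrpd : X.IsOpenGrpd
  quasiSober_obj : QuasiSober X.Obj
  t0_obj : T0Space X.Obj
  quasiSober_arr : QuasiSober X.Arr
  t0_arr : T0Space X.Arr
  isBipullback : IsBipullbackWEP (squareIso X)

end TopGrpd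

/-!
The inverse image of a geometric morphism from `Sh(X)` to the topos of a sober space `S` is
determined by what it does to the open subsets of `S`, which are the subterminal sheaves: it gives a
frame homomorphism from the opens of `S` to the opens of `X₀`, hence a continuous map `X₀ → S`.

An isomorphism `Sh(Φ)* ≅ Sh(Ψ)*` restricts along `u_X` to a cone with vertex `Sh(X₀)` over the
square of `Y`. The bi-pullback property turns it into a geometric morphism `Sh(X₀) → Sh(Y₁)`, which
is a continuous map `a : X₀ → Y₁`, and comparing the cones shows that `a x` goes from `Φ x` to `Ψ x`
and acts on the fibres of sheaves as the given isomorphism does.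

Fullness of the comparison functor of the bi-pullback at the one-point space shows that parallel
arrows of `Y` which act in the same way on all sheaves are equal. This makes `a` natural and unique.
-/

namespace TopGrpd
namespace Sh

section Morphisms

variable {X : TopGrpd.{u}}

lemma congr_toFun {V W : Sh X} {f g : V ⟶ W} (h : f = g) (v : V) :
    Hom.toFun f v = Hom.toFun g v :=
  congrArg (fun m => Hom.toFun m v) h

lemma isIso_of_bijective {V W : Sh X} (f : V ⟶ W) (hf : Function.Bijective (Hom.toFun f)) :
    IsIso f := by
  let e := (Hom.isLocalHomeomorph f).toHomeomorphOfBijective hf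
  have he (w : W) : Hom.toFun f (e.symm w) = w := e.apply_symm_apply w
  let g : W ⟶ V :=
    { toFun := e.symm
      continuous_toFun := e.symm.continuous
      proj_toFun w := by rw [← Hom.proj_toFun f, he]
      map_act k w h := hf.1 <| by
        rw [he, Hom.map_act]
        exact act_congr W rfl (he w).symm _ _ }
  exact ⟨g, hom_ext fun v => e.symm_apply_apply v, hom_ext he⟩

lemma mono_iff_injective {V W : Sh X} (f : V ⟶ W) :
    Mono f ↔ Function.Injective (Hom.toFun f) := by
  refine ⟨fun _ v v' h => ?_, fun hf => ⟨fun g k h => hom_ext fun v => hf ?_⟩⟩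
  · exact congr_toFun ((cancel_mono f).1 (fibProd_w f f)) ⟨(v, v'), h⟩
  · exact congr_toFun h v

/-- The morphism to the terminal sheaf. -/
def toTerminal (W : Sh X) : W ⟶ terminal X where
  toFun := W.proj
  continuous_toFun := W.continuous_proj
  proj_toFun _ := rfl
  map_act g w e := W.str.proj_act g w e

lemma proj_bijective_iff_isTerminal {T : Sh X} :
    Function.Bijective T.proj ↔ Nonempty (IsTerminal T) := by
  refine ⟨fun h => ⟨isTerminalOfBijective T h⟩, fun ⟨hT⟩ => ⟨?_, fun x => ?_⟩⟩
  · exact (mono_iff_injective (toTerminal T)).1 (hT.mono_from _)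
  · exact ⟨Hom.toFun (hT.from (terminal X)) x, Hom.proj_toFun _ _⟩

lemma proj_map_bijective {Y : TopGrpd.{u}} (L : Sh X ⥤ Sh Y) [PreservesFiniteLimits L] {T : Sh X}
    (hT : Function.Bijective T.proj) : Function.Bijective (L.obj T).proj := by
  obtain ⟨h⟩ := proj_bijective_iff_isTerminal.1 hT
  exact proj_bijective_iff_isTerminal.2 ⟨h.isTerminalObj L⟩

lemma proj_map_injective {Y : TopGrpd.{u}} (L : Sh X ⥤ Sh Y) [PreservesFiniteLimits L] {W : Sh X}
    (hW : Function.Injective W.proj) : Function.Injective (L.obj W).proj := by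
  have : Mono (toTerminal W) := (mono_iff_injective _).2 hW
  have hcomp : (L.obj (terminal X)).proj ∘ Hom.toFun (L.map (toTerminal W)) = (L.obj W).proj :=
    funext (Hom.proj_toFun _)
  rw [← hcomp]
  exact (proj_map_bijective L Function.bijective_id).1.comp
    ((mono_iff_injective _).1 inferInstance)

lemma nonempty_hom_of_range_subset {V W : Sh X} (hW : Function.Injective W.proj)
    (h : Set.range V.proj ⊆ Set.range W.proj) : Nonempty (V ⟶ W) := by
  choose f hf using fun v => h ⟨v, rfl⟩
  refine ⟨⟨f, ?_, hf, fun g v e => hW ?_⟩⟩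
  · rw [(W.str.isLocalHomeomorph_proj.isOpenEmbedding_of_injective hW).continuous_iff]
    exact V.continuous_proj.congr fun v => (hf v).symm
  · exact (hf _).trans ((V.str.proj_act _ _ _).trans (W.str.proj_act _ _ _).symm)

lemma exists_map_fibProd_eq {Y : TopGrpd.{u}} (L : Sh X ⥤ Sh Y) [PreservesFiniteLimits L]
    {A B C : Sh X} {f : A ⟶ C} {g : B ⟶ C} {a : L.obj A} {b : L.obj B}
    (h : Hom.toFun (L.map f) a = Hom.toFun (L.map g) b) :
    ∃ p, Hom.toFun (L.map (fibProdFst f g)) p = a ∧ Hom.toFun (L.map (fibProdSnd f g)) p = b := by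
  let h' := (isPullback_fibProd f g).map L
  let p : fibProd (L.map f) (L.map g) := ⟨(a, b), h⟩
  exact ⟨Hom.toFun (h'.lift _ _ (fibProd_w (L.map f) (L.map g))) p,
    congr_toFun (h'.lift_fst _ _ _) p, congr_toFun (h'.lift_snd _ _ _) p⟩

/-- A family of morphisms of sheaves with common target whose images cover the target. -/
def JointlySurjective {ι : Sort*} {A : ι → Sh X} {B : Sh X} (f : ∀ i, A i ⟶ B) : Prop :=
  ∀ b : B, ∃ i a, Hom.toFun (f i) a = b

namespace JointlySurjective

variable {ι : Sort*} {A : ι → Sh X} {B C : Sh X} {f : ∀ i, A i ⟶ B}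

lemma exists_desc (hf : JointlySurjective f) (g : ∀ i, A i ⟶ C)
    (hfg : ∀ i j a a', Hom.toFun (f i) a = Hom.toFun (f j) a' →
      Hom.toFun (g i) a = Hom.toFun (g j) a') :
    ∃ φ : B ⟶ C, ∀ i, f i ≫ φ = g i := by
  choose i a ha using hf
  let F (b : B) : C := Hom.toFun (g (i b)) (a b)
  have hF (j : ι) (c : A j) : F (Hom.toFun (f j) c) = Hom.toFun (g j) c := hfg _ _ _ _ (ha _)
  refine ⟨{ toFun := F, continuous_toFun := ?_, proj_toFun b := ?_, map_act k b e := ?_ },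
    fun j => hom_ext (hF j)⟩
  · refine continuous_of_cover fun b => ⟨_, f (i b), a b, ha b, ?_⟩
    simpa only [hF] using Hom.continuous_toFun (g (i b))
  · rw [Hom.proj_toFun, ← Hom.proj_toFun (f (i b)), ha]
  · have e' : X.src k = (A (i b)).proj (a b) := by rw [e, ← Hom.proj_toFun (f (i b)), ha]
    have hb : B.act k b e = Hom.toFun (f (i b)) ((A (i b)).act k (a b) e') := by
      rw [Hom.map_act]
      exact act_congr B rfl (ha b).symm _ _
    rw [hb, hF, Hom.map_act]

lemma hom_ext (hf : JointlySurjective f) {φ ψ : B ⟶ C} (h : ∀ i, f i ≫ φ = f i ≫ ψ) : φ = ψ := by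
  refine Sh.hom_ext fun b => ?_
  obtain ⟨i, a, rfl⟩ := hf b
  exact congr_toFun (h i) a

lemma isOpen_image (f : ∀ i, A i ⟶ B) : IsOpen {b | ∃ i a, Hom.toFun (f i) a = b} := by
  have : {b | ∃ i a, Hom.toFun (f i) a = b} = ⋃ i, Set.range (Hom.toFun (f i)) := by
    ext
    simp
  rw [this]
  exact isOpen_iUnion fun i => (Hom.isLocalHomeomorph (f i)).isOpenMap.isOpen_range

/-- The joint image of a family of morphisms of sheaves. -/
def image (f : ∀ i, A i ⟶ B) : Sh X :=
  sub B {b | ∃ i a, Hom.toFun (f i) a = b} (isOpen_image f) <| by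
    rintro k _ e ⟨i, a, rfl⟩
    exact ⟨i, (A i).act k a (e.trans (Hom.proj_toFun (f i) a)), Hom.map_act _ _ _ _⟩

/-- The inclusion of the joint image. -/
def imageι (f : ∀ i, A i ⟶ B) : image f ⟶ B := subι _ _ _ _

/-- The factorization of a member of a family through the joint image. -/
def toImage (f : ∀ i, A i ⟶ B) (i : ι) : A i ⟶ image f where
  toFun a := ⟨Hom.toFun (f i) a, i, a, rfl⟩
  continuous_toFun := (Hom.continuous_toFun (f i)).subtype_mk _
  proj_toFun a := Hom.proj_toFun (f i) a
  map_act k a e := Subtype.ext (Hom.map_act (f i) k a e)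

/-- The unit of the adjunction factors through the image under `R` of the joint image of the family
`L.map (f i)`, because the pullback of that subobject along the unit contains every `f i`. -/
lemma map {Y : TopGrpd.{u}} {L : Sh X ⥤ Sh Y} {R : Sh Y ⥤ Sh X} (adj : L ⊣ R)
    (hf : JointlySurjective f) : JointlySurjective fun i => L.map (f i) := by
  let ι' := imageι fun i => L.map (f i)
  have : Mono ι' := (mono_iff_injective _).2 Subtype.val_injective
  have := adj.rightAdjoint_preservesLimits
  let pr : fibProd (R.map ι') (adj.unit.app B) ⟶ B := fibProdSnd _ _
  have hinj : Function.Injective (Hom.toFun pr) := by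
    rintro ⟨⟨c, b⟩, h⟩ ⟨⟨c', b'⟩, h'⟩ (rfl : b = b')
    exact Subtype.ext (Prod.ext ((mono_iff_injective (R.map ι')).1 inferInstance (h.trans h'.symm))
      rfl)
  have hsurj : Function.Surjective (Hom.toFun pr) := by
    intro b
    obtain ⟨i, a, rfl⟩ := hf b
    have hfac : adj.homEquiv _ _ (toImage (fun i => L.map (f i)) i) ≫ R.map ι' =
        f i ≫ adj.unit.app B := by
      rw [← adj.homEquiv_naturality_right, ← adj.homEquiv_id, ← adj.homEquiv_naturality_left,
        Category.comp_id]
      rfl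
    exact ⟨⟨(_, Hom.toFun (f i) a), congr_toFun hfac a⟩, rfl⟩
  have := isIso_of_bijective pr ⟨hinj, hsurj⟩
  let σ : B ⟶ R.obj (image fun i => L.map (f i)) := CategoryTheory.inv pr ≫ fibProdFst _ _
  have hσ : σ ≫ R.map ι' = adj.unit.app B := by
    rw [Category.assoc, fibProd_w, IsIso.inv_hom_id_assoc]
  have hsplit : (adj.homEquiv _ _).symm σ ≫ ι' = 𝟙 (L.obj B) := by
    rw [← adj.homEquiv_naturality_right_symm, hσ, ← adj.homEquiv_id, Equiv.symm_apply_apply]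
  intro b
  obtain ⟨i, a, h⟩ := (Hom.toFun ((adj.homEquiv _ _).symm σ) b).2
  exact ⟨i, a, h.trans (congr_toFun hsplit b)⟩

end JointlySurjective

end Morphisms

section Space

open TopologicalSpace Opposite

variable {S : Type u} [TopologicalSpace S]

/-- An étale space over `S` as a sheaf on the groupoid `disc S`. -/
def ofEtale {W : Type u} [TopologicalSpace W] (q : W → S) (hq : IsLocalHomeomorph q) :
    Sh (disc S) where
  carrier := W
  str :=
    { proj := q
      isLocalHomeomorph_proj := hq
      act := fun _ w _ => w
      continuous_act := continuous_snd.comp continuous_subtype_val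
      proj_act := fun _ _ e => e.symm
      act_one := fun _ => rfl
      act_comp := fun _ _ _ _ _ => rfl }

lemma act_disc (W : Sh (disc S)) (g : (disc S).Arr) (w : W) (e : (disc S).src g = W.proj w) :
    W.act g w e = w :=
  (act_congr W e rfl e rfl).trans (W.str.act_one w)

/-- A continuous map over the base space as a morphism of sheaves. -/
def discHom {V W : Sh (disc S)} (f : V → W) (hf : Continuous f)
    (hp : ∀ v, W.proj (f v) = V.proj v) : V ⟶ W where
  toFun := f
  continuous_toFun := hf
  proj_toFun := hp
  map_act g v e := by rw [act_disc, act_disc]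

/-- The subterminal sheaf of an open subset. Morphisms `openSheaf U ⟶ W` are the sections of `W`
over `U`. -/
def openSheaf (U : Opens S) : Sh (disc S) :=
  ofEtale (W := U) Subtype.val U.isOpen.isOpenEmbedding_subtypeVal.isLocalHomeomorph

/-- The morphism to `openSheaf U` from a sheaf supported in `U`. -/
def toOpenSheaf (W : Sh (disc S)) {U : Opens S} (h : ∀ w, W.proj w ∈ U) : W ⟶ openSheaf U :=
  discHom (W := openSheaf U) (fun w => ⟨W.proj w, h w⟩) (W.continuous_proj.subtype_mk h)
    fun _ => rfl

lemma exists_section (W : Sh (disc S)) (w : W) :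
    ∃ (U : Opens S) (h : W.proj w ∈ U) (σ : openSheaf U ⟶ W), Hom.toFun σ ⟨W.proj w, h⟩ = w := by
  obtain ⟨e, hw, he⟩ := W.str.isLocalHomeomorph_proj w
  have hproj (v : W) : W.proj v = e v := congrFun he v
  have hsymm (z : e.target) : W.proj (e.symm z) = z := (hproj _).trans (e.right_inv z.2)
  refine ⟨⟨e.target, e.open_target⟩, hproj w ▸ e.map_source hw,
    discHom (V := openSheaf _) (fun z => e.symm z.1) ?_ hsymm, ?_⟩
  · exact continuousOn_iff_continuous_domRestrict.mp e.continuousOn_symm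
  · exact (congrArg e.symm (hproj w)).trans (e.left_inv hw)

lemma jointlySurjective_sections (W : Sh (disc S)) :
    JointlySurjective fun σ : Σ U : Opens S, openSheaf U ⟶ W => σ.2 := fun w =>
  let ⟨U, h, σ, hσ⟩ := exists_section W w
  ⟨⟨U, σ⟩, ⟨W.proj w, h⟩, hσ⟩

lemma eq_of_section_eq {W : Sh (disc S)} {U V : Opens S} {σ : openSheaf U ⟶ W}
    {τ : openSheaf V ⟶ W} {x : U} {y : V} (h : Hom.toFun σ x = Hom.toFun τ y) : (x : S) = y :=
  (Hom.proj_toFun σ x).symm.trans ((congrArg W.proj h).trans (Hom.proj_toFun τ y))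

/-- The open set on which two sections are defined and agree. -/
def eqLocus {W : Sh (disc S)} {U V : Opens S} (σ : openSheaf U ⟶ W) (τ : openSheaf V ⟶ W) :
    Opens S :=
  ⟨Set.range (fibProd σ τ).proj, (fibProd σ τ).str.isLocalHomeomorph_proj.isOpenMap.isOpen_range⟩

lemma mem_eqLocus {W : Sh (disc S)} {U V : Opens S} {σ : openSheaf U ⟶ W} {τ : openSheaf V ⟶ W}
    {x : S} : x ∈ eqLocus σ τ ↔
      ∃ (hU : x ∈ U) (hV : x ∈ V), Hom.toFun σ ⟨x, hU⟩ = Hom.toFun τ ⟨x, hV⟩ := by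
  constructor
  · rintro ⟨⟨⟨⟨x, hU⟩, ⟨y, hV⟩⟩, h⟩, rfl⟩
    obtain rfl : x = y := eq_of_section_eq h
    exact ⟨hU, hV, h⟩
  · rintro ⟨hU, hV, h⟩
    exact ⟨⟨(⟨x, hU⟩, ⟨x, hV⟩), h⟩, rfl⟩

section Sections

/-- The sheaf of sections of an étale space. -/
def sectionsSheaf (W : Sh (disc S)) : TopCat.Sheaf (Type u) (TopCat.of S) :=
  TopCat.subsheafToTypes ((TopCat.continuousLocal (TopCat.of S) W.carrier).and
    (TopCat.isSection (X := TopCat.of S) W.proj))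

/-- Sections of an étale space as morphisms out of subterminal sheaves. -/
def sectionsEquiv {W : Sh (disc S)} {U : Opens S} :
    (sectionsSheaf W).1.obj (op U) ≃ (openSheaf U ⟶ W) where
  toFun s := discHom (V := openSheaf U) s.1 s.2.1 (congrFun s.2.2)
  invFun σ := ⟨Hom.toFun σ, Hom.continuous_toFun σ, funext (Hom.proj_toFun σ)⟩
  left_inv _ := rfl
  right_inv _ := rfl

lemma sectionsSheaf_ext {W : Sh (disc S)} {U : (Opens (TopCat.of S))ᵒᵖ}
    {s t : (sectionsSheaf W).1.obj U} (h : ∀ x, s.1 x = t.1 x) : s = t :=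
  Subtype.ext (funext h)

variable (S) in
/-- The functor which sends an étale space to its sheaf of sections. -/
def sectionsFunctor : Sh (disc S) ⥤ TopCat.Sheaf (Type u) (TopCat.of S) where
  obj W := sectionsSheaf W
  map f :=
    ⟨{ app := fun _ => TypeCat.ofHom fun s => ⟨fun x => Hom.toFun f (s.1 x),
          (Hom.continuous_toFun f).comp s.2.1,
          funext fun x => (Hom.proj_toFun f _).trans (congrFun s.2.2 x)⟩
       naturality := fun _ _ _ => rfl }⟩
  map_id _ := rfl
  map_comp _ _ := rfl

instance : (sectionsFunctor S).Faithful where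
  map_injective {V W f g} h := by
    refine (jointlySurjective_sections V).hom_ext fun ⟨U, σ⟩ => ?_
    have happ : sectionsEquiv.symm (σ ≫ f) = sectionsEquiv.symm (σ ≫ g) :=
      congrArg (fun m : sectionsSheaf V ⟶ sectionsSheaf W =>
        m.1.app (op U) (sectionsEquiv.symm σ)) h
    exact sectionsEquiv.symm.injective happ

lemma sections_app_congr {V W : Sh (disc S)} (η : sectionsSheaf V ⟶ sectionsSheaf W)
    {U U' : Opens (TopCat.of S)} (s : (sectionsSheaf V).1.obj (op U))
    (t : (sectionsSheaf V).1.obj (op U')) {x : S} (hx : x ∈ U) (hx' : x ∈ U')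
    (h : s.1 ⟨x, hx⟩ = t.1 ⟨x, hx'⟩) :
    (η.1.app (op U) s).1 ⟨x, hx⟩ = (η.1.app (op U') t).1 ⟨x, hx'⟩ := by
  let N : Opens (TopCat.of S) := eqLocus (sectionsEquiv s) (sectionsEquiv t)
  have hNU : N ≤ U := fun z hz => (mem_eqLocus.1 hz).1
  have hNU' : N ≤ U' := fun z hz => (mem_eqLocus.1 hz).2.1
  have hres : (sectionsSheaf V).1.map (homOfLE hNU).op s =
      (sectionsSheaf V).1.map (homOfLE hNU').op t :=
    sectionsSheaf_ext fun z => (mem_eqLocus.1 z.2).2.2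
  have hηs := ConcreteCategory.congr_hom (η.1.naturality (homOfLE hNU).op) s
  have hηt := ConcreteCategory.congr_hom (η.1.naturality (homOfLE hNU').op) t
  have hη : (sectionsSheaf W).1.map (homOfLE hNU).op (η.1.app (op U) s) =
      (sectionsSheaf W).1.map (homOfLE hNU').op (η.1.app (op U') t) :=
    hηs.symm.trans ((congrArg (η.1.app (op N)) hres).trans hηt)
  exact congrArg (fun r : (sectionsSheaf W).1.obj (op N) => r.1 ⟨x, mem_eqLocus.2 ⟨hx, hx', h⟩⟩) hη

instance : (sectionsFunctor S).Full where
  map_surjective {V W} η := by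
    change sectionsSheaf V ⟶ sectionsSheaf W at η
    obtain ⟨φ, hφ⟩ := (jointlySurjective_sections V).exists_desc
      (fun σ => sectionsEquiv (η.1.app (op σ.1) (sectionsEquiv.symm σ.2))) (by
        rintro ⟨U, σ⟩ ⟨U', τ⟩ ⟨x, hx⟩ ⟨y, hy⟩ h
        obtain rfl : x = y := eq_of_section_eq h
        exact sections_app_congr η (sectionsEquiv.symm σ) (sectionsEquiv.symm τ) hx hy h)
    refine ⟨φ, Sheaf.hom_ext (NatTrans.ext (funext fun U => ?_))⟩
    ext s
    exact sectionsSheaf_ext fun x => congr_toFun (hφ ⟨U.unop, sectionsEquiv s⟩) x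

end Sections

section EtaleSpace

lemma continuous_germ (F : TopCat.Presheaf (Type u) (TopCat.of S)) {U : Opens (TopCat.of S)}
    (s : F.obj (op U)) :
    Continuous fun x : U => (⟨x.1, F.germ U x.1 x.2 s⟩ : F.EtaleSpace) := by
  rw [continuous_generateFrom_iff]
  rintro _ ⟨V, t, rfl⟩
  rw [isOpen_iff_mem_nhds]
  rintro x ⟨hxV, hx⟩
  obtain ⟨N, hxN, iU, iV, hN⟩ := F.germ_eq _ _ _ _ _ hx
  filter_upwards [N.isOpen.preimage continuous_subtype_val |>.mem_nhds hxN] with z hz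
  refine ⟨iV.le hz, ?_⟩
  change F.germ U z.1 z.2 s = F.germ V z.1 _ t
  rw [← F.germ_res_apply iU z.1 hz, hN, F.germ_res_apply]

lemma isLocalHomeomorph_base (F : TopCat.Presheaf (Type u) (TopCat.of S)) :
    IsLocalHomeomorph (TopCat.Presheaf.EtaleSpace.base (F := F)) := by
  refine isLocalHomeomorph_of (TopCat.Presheaf.EtaleSpace.continuous_base F) ?_ ?_
  · rw [isOpenMap_iff_nhds_le]
    rintro ⟨x, g⟩
    obtain ⟨U, hx, s, rfl⟩ := F.exists_germ_eq g
    refine (U.isOpen.isOpenEmbedding_subtypeVal.map_nhds_eq ⟨x, hx⟩).ge.trans ?_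
    exact Filter.map_mono (m := TopCat.Presheaf.EtaleSpace.base (F := F))
      ((continuous_germ F s).continuousAt (x := ⟨x, hx⟩))
  · rintro ⟨x, g⟩
    obtain ⟨U, hx, s, rfl⟩ := F.exists_germ_eq g
    refine ⟨{g | ∃ h, g.germ = F.germ U g.base h s},
      TopologicalSpace.isOpen_generateFrom_of_mem ⟨U, s, rfl⟩, ⟨hx, rfl⟩, ?_⟩
    rintro ⟨y, g⟩ ⟨hy, hg⟩ ⟨y', g'⟩ ⟨hy', hg'⟩ (rfl : y = y')
    exact congrArg (TopCat.Presheaf.EtaleSpace.mk y) (hg.trans hg'.symm)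

/-- The étale space of a sheaf on a space. -/
noncomputable def etaleSheaf (F : TopCat.Sheaf (Type u) (TopCat.of S)) : Sh (disc S) :=
  ofEtale (S := S) (TopCat.Presheaf.EtaleSpace.base (F := F.1)) (isLocalHomeomorph_base F.1)

/-- The map which sends a section to its germs. -/
noncomputable def toSections (F : TopCat.Sheaf (Type u) (TopCat.of S)) :
    F ⟶ sectionsSheaf (etaleSheaf F) :=
  ⟨{ app := fun U => TypeCat.ofHom fun s =>
        ⟨fun x => ⟨x.1, F.presheaf.germ U.unop x.1 x.2 s⟩, continuous_germ F.1 s, rfl⟩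
     naturality := fun U V i => by
        ext s
        exact sectionsSheaf_ext fun x => congrArg (TopCat.Presheaf.EtaleSpace.mk x.1)
          (F.presheaf.germ_res_apply i.unop x.1 x.2 s) }⟩

lemma toSections_injective (F : TopCat.Sheaf (Type u) (TopCat.of S)) (U : Opens (TopCat.of S)) :
    Function.Injective ((toSections F).1.app (op U)) := by
  refine fun s t h => TopCat.Presheaf.section_ext F U s t fun x hx => ?_
  have hgerm := congrArg (fun r : (sectionsSheaf (etaleSheaf F)).1.obj (op U) => r.1 ⟨x, hx⟩) h
  injection hgerm

lemma toSections_locally_surjective (F : TopCat.Sheaf (Type u) (TopCat.of S))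
    {U : Opens (TopCat.of S)} (t : (sectionsSheaf (etaleSheaf F)).1.obj (op U)) (x : U) :
    ∃ (V : Opens (TopCat.of S)) (_ : x.1 ∈ V) (hVU : V ≤ U) (s : F.1.obj (op V)),
      (toSections F).1.app (op V) s = (sectionsSheaf (etaleSheaf F)).1.map (homOfLE hVU).op t := by
  obtain ⟨O, hO, s, hs⟩ := F.presheaf.exists_germ_eq (t.1 x).germ
  have hev := (t.2.1.continuousAt (x := x)).eventually
    (TopCat.Presheaf.EtaleSpace.eventually_nhds (t.1 x) hO s hs)
  obtain ⟨N, hN, hNo, hxN⟩ := eventually_nhds_iff.1 hev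
  have ht (y : U) (hy : y ∈ N) :
      ∃ h : y.1 ∈ O, (⟨y.1, F.presheaf.germ O y.1 h s⟩ : F.presheaf.EtaleSpace) = t.1 y := by
    have hbase : (t.1 y).base = y := congrFun t.2.2 y
    have hgerm := hN y hy
    generalize t.1 y = g at hbase hgerm
    obtain ⟨z, g⟩ := g
    change z = y at hbase
    subst hbase
    obtain ⟨h, hg⟩ := hgerm
    exact ⟨h, congrArg _ hg.symm⟩
  let V : Opens (TopCat.of S) := ⟨Subtype.val '' N, U.isOpen.isOpenMap_subtype_val _ hNo⟩
  have hVU : V ≤ U := Subtype.coe_image_subset _ _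
  have hVO : V ≤ O := by
    rintro _ ⟨y, hy, rfl⟩
    exact (ht y hy).1
  refine ⟨V, ⟨x, hxN, rfl⟩, hVU, F.1.map (homOfLE hVO).op s, sectionsSheaf_ext ?_⟩
  rintro ⟨_, y, hy, rfl⟩
  refine Eq.trans ?_ (ht y hy).2
  exact congrArg (TopCat.Presheaf.EtaleSpace.mk y.1)
    (F.presheaf.germ_res_apply (homOfLE hVO) _ _ s)

lemma toSections_surjective (F : TopCat.Sheaf (Type u) (TopCat.of S)) (U : Opens (TopCat.of S)) :
    Function.Surjective ((toSections F).1.app (op U)) := by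
  intro t
  choose V hxV hVU s hs using toSections_locally_surjective F t
  have hgerm (x : U) (y : V x) :
      (⟨y.1, F.presheaf.germ (V x) y.1 y.2 (s x)⟩ : F.presheaf.EtaleSpace) =
        t.1 ⟨y.1, hVU x y.2⟩ :=
    congrArg (fun r : (sectionsSheaf (etaleSheaf F)).1.obj (op (V x)) => r.1 y) (hs x)
  have hcompat : F.presheaf.IsCompatible V s := by
    refine fun x y => TopCat.Presheaf.section_ext F _ _ _ fun z hz => ?_
    injection (hgerm x ⟨z, hz.1⟩).trans (hgerm y ⟨z, hz.2⟩).symm with _ hxy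
    rw [F.presheaf.germ_res_apply, F.presheaf.germ_res_apply]
    exact hxy
  have hcover : U ≤ iSup V := fun x hx => Opens.mem_iSup.2 ⟨⟨x, hx⟩, hxV ⟨x, hx⟩⟩
  obtain ⟨r, hr, -⟩ :=
    F.existsUnique_gluing' V U (fun x => homOfLE (hVU x)) hcover s hcompat
  refine ⟨r, sectionsSheaf_ext fun x => Eq.trans ?_ (hgerm x ⟨x, hxV x⟩)⟩
  refine congrArg (TopCat.Presheaf.EtaleSpace.mk x.1) ?_
  rw [← hr x, F.presheaf.germ_res_apply]

instance : (sectionsFunctor S).EssSurj where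
  mem_essImage F := by
    have : IsIso (toSections F).1 := by
      rw [NatTrans.isIso_iff_isIso_app]
      exact fun U => (isIso_iff_bijective _).2
        ⟨toSections_injective F U.unop, toSections_surjective F U.unop⟩
    have : IsIso (toSections F) :=
      (isIso_iff_of_reflects_iso _ (TopCat.Sheaf.forget (Type u) (TopCat.of S))).1 this
    exact ⟨etaleSheaf F, ⟨(asIso (toSections F)).symm⟩⟩

lemma isGrothendieckTopos_disc : IsGrothendieckTopos (Sh (disc S)) := by
  have : (sectionsFunctor S).IsEquivalence := {}
  exact ⟨Opens (TopCat.of S), inferInstance, Opens.grothendieckTopology (TopCat.of S),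
    ⟨(sectionsFunctor S).asEquivalence⟩⟩

end EtaleSpace

section Points

/-- The underlying set of a sheaf on the point. -/
def forgetPoint : Sh (disc PUnit.{u + 1}) ⥤ Type u where
  obj W := W.carrier
  map f := TypeCat.ofHom (Hom.toFun f)
  map_id _ := rfl
  map_comp _ _ := rfl

lemma discreteTopology_of_point (W : Sh (disc PUnit.{u + 1})) : DiscreteTopology W := by
  have : DiscreteTopology (disc PUnit.{u + 1}).Obj := inferInstanceAs (DiscreteTopology PUnit)
  exact W.str.isLocalHomeomorph_proj.comap_discreteTopology

instance : forgetPoint.{u}.Faithful where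
  map_injective h := hom_ext fun v => congrArg (fun m => m v) h

instance : forgetPoint.{u}.Full where
  map_surjective {V W} f := by
    have := discreteTopology_of_point V
    exact ⟨discHom f continuous_of_discreteTopology fun _ => rfl, rfl⟩

instance : forgetPoint.{u}.EssSurj where
  mem_essImage A := by
    let _ : TopologicalSpace A := ⊥
    have : DiscreteTopology A := ⟨rfl⟩
    refine ⟨ofEtale (S := PUnit.{u + 1}) (W := A) (fun _ => PUnit.unit) ?_, ⟨Iso.refl _⟩⟩
    exact isLocalHomeomorph_of continuous_const (fun _ _ => isOpen_discrete _)
      (fun a => ⟨{a}, isOpen_discrete _, rfl, Set.injOn_singleton _ _⟩)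

instance : forgetPoint.{u}.IsEquivalence := {}

/-- The point of the topos `Sh(S)` given by a point of `S`. Its inverse image sends an étale space
to its fibre. -/
noncomputable def pointGeom (x : S) : GeomMorphism (Type u) (Sh (disc S)) where
  inv := inverseImage (discMap (fun _ : PUnit.{u + 1} => x) continuous_const) ⋙ forgetPoint
  dir := _
  adj := Adjunction.ofIsLeftAdjoint _
  leftExact := comp_preservesFiniteLimits _ _

lemma toposHasEnoughPoints_disc : ToposHasEnoughPoints (Sh (disc S)) := by
  intro A B f hf
  have hbij (x : S) : Function.Bijective ((pointGeom x).inv.map f) :=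
    (isIso_iff_bijective _).1 (hf (pointGeom x))
  refine isIso_of_bijective f ⟨fun a a' h => ?_, fun b => ?_⟩
  · have hp : A.proj a = A.proj a' := by rw [← Hom.proj_toFun f, h, Hom.proj_toFun f]
    have hfib := (hbij (A.proj a)).1
      (a₁ := (⟨(PUnit.unit, a), rfl⟩ : {p : PUnit × A // A.proj a = A.proj p.2}))
      (a₂ := (⟨(PUnit.unit, a'), hp⟩ : {p : PUnit × A // A.proj a = A.proj p.2}))
      (Subtype.ext (Prod.ext rfl h))
    exact congrArg (fun p : {p : PUnit × A // A.proj a = A.proj p.2} => p.1.2) hfib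
  · obtain ⟨p, hp⟩ := (hbij (B.proj b)).2
      (⟨(PUnit.unit, b), rfl⟩ : {p : PUnit × B // B.proj b = B.proj p.2})
    exact ⟨p.1.2, congrArg (fun p : {p : PUnit × B // B.proj b = B.proj p.2} => p.1.2) hp⟩

end Points

end Space

section GeometricMorphismsToSpaces

open TopologicalSpace

section Support

variable {X : TopGrpd.{u}}

/-- The open set of objects over which a sheaf is inhabited. -/
def support (W : Sh X) : Opens X.Obj :=
  ⟨Set.range W.proj, W.str.isLocalHomeomorph_proj.isOpenMap.isOpen_range⟩

lemma proj_mem_support {W : Sh X} (w : W) : W.proj w ∈ support W := ⟨w, rfl⟩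

lemma support_mono {V W : Sh X} (f : V ⟶ W) : support V ≤ support W := by
  rintro _ ⟨v, rfl⟩
  exact ⟨Hom.toFun f v, Hom.proj_toFun f v⟩

lemma tgt_mem_support {W : Sh X} {g : X.Arr} (h : X.src g ∈ support W) : X.tgt g ∈ support W := by
  obtain ⟨w, hw⟩ := h
  exact ⟨W.act g w hw.symm, W.str.proj_act _ _ _⟩

lemma src_mem_support_iff_tgt_mem_support {W : Sh X} {g : X.Arr} :
    X.src g ∈ support W ↔ X.tgt g ∈ support W := by
  refine ⟨tgt_mem_support, fun h => ?_⟩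
  rw [← X.src_inv] at h
  exact X.tgt_inv g ▸ tgt_mem_support h

end Support

variable {X : TopGrpd.{u}} {S : Type u} [TopologicalSpace S]

lemma support_inverseImage_openSheaf (Φ : ContFunctor X (disc S)) (U : Opens S) :
    support ((inverseImage Φ).obj (openSheaf U)) = Opens.comap ⟨Φ.obj, Φ.continuous_obj⟩ U := by
  ext x
  constructor
  · rintro ⟨⟨⟨x, ⟨z, hz⟩⟩, h⟩, rfl⟩
    obtain rfl : Φ.obj x = z := h
    exact hz
  · exact fun h => ⟨⟨(x, ⟨Φ.obj x, h⟩), rfl⟩, rfl⟩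

/-- The inclusion of subterminal sheaves. -/
def openSheafMap {U V : Opens S} (h : U ≤ V) : openSheaf U ⟶ openSheaf V :=
  toOpenSheaf (openSheaf U) fun x => h x.2

variable {L L' : Sh (disc S) ⥤ Sh X} {R R' : Sh X ⥤ Sh (disc S)}

lemma proj_map_openSheaf_injective (L : Sh (disc S) ⥤ Sh X) [PreservesFiniteLimits L]
    (U : Opens S) : Function.Injective (L.obj (openSheaf U)).proj :=
  proj_map_injective L Subtype.val_injective

/-- The frame homomorphism underlying a left exact left adjoint between categories of sheaves, where
open sets are identified with the supports of subterminal sheaves. -/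
def supportHom [PreservesFiniteLimits L] (adj : L ⊣ R) : FrameHom (Opens S) (Opens X.Obj) where
  toFun U := support (L.obj (openSheaf U))
  map_top' := by
    refine SetLike.coe_injective (proj_map_bijective L ⟨Subtype.val_injective, ?_⟩).2.range_eq
    exact fun x => ⟨⟨x, trivial⟩, rfl⟩
  map_inf' U V := by
    refine le_antisymm (le_inf (support_mono (L.map (openSheafMap inf_le_left)))
      (support_mono (L.map (openSheafMap inf_le_right)))) ?_
    rintro _ ⟨⟨a, rfl⟩, b, hb⟩
    obtain ⟨p, hp, -⟩ := exists_map_fibProd_eq L (a := a) (b := b)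
      (f := openSheafMap le_top) (g := openSheafMap le_top)
      (proj_map_openSheaf_injective L ⊤ (by rw [Hom.proj_toFun, Hom.proj_toFun, hb]))
    rw [← hp, Hom.proj_toFun]
    refine support_mono (L.map (toOpenSheaf _ ?_)) (proj_mem_support p)
    rintro ⟨⟨⟨x, hx⟩, ⟨y, hy⟩⟩, h⟩
    obtain rfl : x = y := congrArg Subtype.val h
    exact ⟨hx, hy⟩
  map_sSup' 𝒰 := by
    let f (U : 𝒰) : openSheaf U.1 ⟶ openSheaf (sSup 𝒰) := openSheafMap (le_sSup U.2)
    have hf : JointlySurjective f := by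
      rintro ⟨x, hx⟩
      obtain ⟨U, hU, hxU⟩ := Opens.mem_sSup.1 hx
      exact ⟨⟨U, hU⟩, ⟨x, hxU⟩, rfl⟩
    refine le_antisymm ?_ (sSup_le ?_)
    · rintro _ ⟨b, rfl⟩
      obtain ⟨U, a, rfl⟩ := hf.map adj b
      rw [Hom.proj_toFun]
      exact Opens.mem_sSup.2 ⟨_, Set.mem_image_of_mem _ U.2, proj_mem_support a⟩
    · rintro _ ⟨U, hU, rfl⟩
      exact support_mono (L.map (f ⟨U, hU⟩))

lemma map_section_eq_iff (L : Sh (disc S) ⥤ Sh X) [PreservesFiniteLimits L] {W : Sh (disc S)}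
    {U V : Opens S} {σ : openSheaf U ⟶ W} {τ : openSheaf V ⟶ W} {a : L.obj (openSheaf U)}
    {b : L.obj (openSheaf V)} :
    Hom.toFun (L.map σ) a = Hom.toFun (L.map τ) b ↔ (L.obj (openSheaf U)).proj a =
      (L.obj (openSheaf V)).proj b ∧
      (L.obj (openSheaf U)).proj a ∈ support (L.obj (openSheaf (eqLocus σ τ))) := by
  constructor
  · intro h
    obtain ⟨p, rfl, hb⟩ := exists_map_fibProd_eq L h
    refine ⟨by rw [← hb, Hom.proj_toFun, Hom.proj_toFun], ?_⟩
    rw [Hom.proj_toFun]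
    let toLocus : fibProd σ τ ⟶ openSheaf (eqLocus σ τ) := toOpenSheaf _ fun q => ⟨q, rfl⟩
    exact support_mono (L.map toLocus) (proj_mem_support p)
  · rintro ⟨hab, c, hc⟩
    let i : openSheaf (eqLocus σ τ) ⟶ openSheaf U := openSheafMap fun _ h => (mem_eqLocus.1 h).1
    let j : openSheaf (eqLocus σ τ) ⟶ openSheaf V := openSheafMap fun _ h => (mem_eqLocus.1 h).2.1
    have hij : i ≫ σ = j ≫ τ := hom_ext fun x => (mem_eqLocus.1 x.2).2.2
    have ha : Hom.toFun (L.map i) c = a :=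
      proj_map_openSheaf_injective L U ((Hom.proj_toFun _ _).trans hc)
    have hb : Hom.toFun (L.map j) c = b :=
      proj_map_openSheaf_injective L V ((Hom.proj_toFun _ _).trans (hc.trans hab))
    rw [← ha, ← hb, ← comp_toFun, ← comp_toFun, ← L.map_comp, ← L.map_comp, hij]

lemma exists_isIso_of_support_eq [PreservesFiniteLimits L] [PreservesFiniteLimits L']
    (adj : L ⊣ R) (adj' : L' ⊣ R')
    (h : ∀ U, support (L.obj (openSheaf U)) = support (L'.obj (openSheaf U)))
    (c : ∀ U, L.obj (openSheaf U) ⟶ L'.obj (openSheaf U)) (W : Sh (disc S)) :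
    ∃ φ : L.obj W ⟶ L'.obj W, IsIso φ ∧
      ∀ {U} (σ : openSheaf U ⟶ W), L.map σ ≫ φ = c U ≫ L'.map σ := by
  have hLL' {U V : Opens S} (σ : openSheaf U ⟶ W) (τ : openSheaf V ⟶ W) (a : L.obj (openSheaf U))
      (b : L.obj (openSheaf V)) : Hom.toFun (L.map σ) a = Hom.toFun (L.map τ) b ↔
      Hom.toFun (L'.map σ) (Hom.toFun (c U) a) = Hom.toFun (L'.map τ) (Hom.toFun (c V) b) := by
    rw [map_section_eq_iff, map_section_eq_iff, Hom.proj_toFun, Hom.proj_toFun, h]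
  have hL := (jointlySurjective_sections W).map adj
  obtain ⟨φ, hφ⟩ := hL.exists_desc (fun σ => c σ.1 ≫ L'.map σ.2)
    fun σ τ a b hab => (hLL' σ.2 τ.2 a b).1 hab
  refine ⟨φ, isIso_of_bijective φ ⟨fun x y hxy => ?_, fun y => ?_⟩, fun σ => hφ ⟨_, σ⟩⟩
  · obtain ⟨σ, a, rfl⟩ := hL x
    obtain ⟨τ, b, rfl⟩ := hL y
    exact (hLL' σ.2 τ.2 a b).2
      ((congr_toFun (hφ σ) a).symm.trans (hxy.trans (congr_toFun (hφ τ) b)))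
  · obtain ⟨σ, b, rfl⟩ := (jointlySurjective_sections W).map adj' y
    obtain ⟨a, ha⟩ := (h σ.1).ge (proj_mem_support b)
    have hcab : Hom.toFun (c σ.1) a = b :=
      proj_map_openSheaf_injective L' σ.1 ((Hom.proj_toFun _ _).trans ha)
    exact ⟨Hom.toFun (L.map σ.2) a, (congr_toFun (hφ σ) a).trans (congrArg _ hcab)⟩

/-- A germ of `L.obj W` is given by a section of `W` and a point of the support of its domain, and
supports also decide when two such germs agree. -/
lemma nonempty_iso_of_support_eq [PreservesFiniteLimits L] [PreservesFiniteLimits L']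
    (adj : L ⊣ R) (adj' : L' ⊣ R')
    (h : ∀ U, support (L.obj (openSheaf U)) = support (L'.obj (openSheaf U))) :
    Nonempty (L ≅ L') := by
  let c U : L.obj (openSheaf U) ⟶ L'.obj (openSheaf U) :=
    (nonempty_hom_of_range_subset (proj_map_openSheaf_injective L' U) (h U).le).some
  choose φ hiso hφ using exists_isIso_of_support_eq adj adj' h c
  refine ⟨NatIso.ofComponents (fun W => asIso (φ W)) fun {W W'} f => ?_⟩
  refine ((jointlySurjective_sections W).map adj).hom_ext fun ⟨U, σ⟩ => ?_
  rw [asIso_hom, asIso_hom, ← L.map_comp_assoc, hφ, L'.map_comp, ← Category.assoc, ← hφ,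
    Category.assoc]

/-- The image of `x` is the generic point of the complement of the union of all `U` with
`x ∉ f U`. -/
lemma exists_continuousMap_comap_eq {T : Type*} [TopologicalSpace T] [QuasiSober S]
    (f : FrameHom (Opens S) (Opens T)) : ∃ k : C(T, S), ∀ U, f U = Opens.comap k U := by
  let N (x : T) : Opens S := sSup {U | x ∉ f U}
  have hN (x : T) (U : Opens S) : x ∈ f U ↔ ¬ U ≤ N x := by
    have hfN : x ∉ f (N x) := by
      rw [map_sSup, Opens.mem_sSup]
      rintro ⟨_, ⟨U, hU, rfl⟩, hx⟩
      exact hU hx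
    exact ⟨fun hx hle => hfN (OrderHomClass.mono f hle hx),
      fun h => by_contra fun hx => h (le_sSup hx)⟩
  have hmeet (x : T) (U : Opens S) : x ∈ f U ↔ ((N x : Set S)ᶜ ∩ U).Nonempty := by
    rw [hN, ← SetLike.coe_subset_coe, Set.not_subset]
    exact ⟨fun ⟨z, hU, hz⟩ => ⟨z, hz, hU⟩, fun ⟨z, hz, hU⟩ => ⟨z, hU, hz⟩⟩
  have hirr (x : T) : IsIrreducible (N x : Set S)ᶜ := by
    refine ⟨?_, fun U V hU hV hxU hxV => ?_⟩
    · obtain ⟨z, hz, -⟩ := (hmeet x ⊤).1 (by rw [map_top]; trivial)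
      exact ⟨z, hz⟩
    · refine (hmeet x (⟨U, hU⟩ ⊓ ⟨V, hV⟩)).1 ?_
      rw [map_inf]
      exact ⟨(hmeet x ⟨U, hU⟩).2 hxU, (hmeet x ⟨V, hV⟩).2 hxV⟩
  choose k hk using fun x => QuasiSober.sober (hirr x) (N x).isOpen.isClosed_compl
  have hmem (x : T) (U : Opens S) : k x ∈ U ↔ x ∈ f U := by
    rw [hmeet]
    exact (hk x).mem_open_set_iff U.isOpen
  have hpre (U : Opens S) : k ⁻¹' U = f U := Set.ext fun x => hmem x U
  exact ⟨⟨k, continuous_def.2 fun U hU => hpre ⟨U, hU⟩ ▸ (f ⟨U, hU⟩).isOpen⟩,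
    fun U => SetLike.coe_injective (hpre U).symm⟩

lemma exists_iso_shGeom [QuasiSober S] [T0Space S] (h : GeomMorphism (Sh X) (Sh (disc S))) :
    ∃ Φ : ContFunctor X (disc S), Nonempty (h ≅ shGeom Φ) := by
  have := h.leftExact
  obtain ⟨k, hk⟩ := exists_continuousMap_comap_eq (supportHom h.adj)
  have hinv (g : X.Arr) : k (X.src g) = k (X.tgt g) := by
    refine Inseparable.eq (inseparable_iff_forall_isOpen.2 fun U hU => ?_)
    change X.src g ∈ Opens.comap k ⟨U, hU⟩ ↔ X.tgt g ∈ Opens.comap k ⟨U, hU⟩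
    rw [← hk]
    exact src_mem_support_iff_tgt_mem_support
  let Φ : ContFunctor X (disc S) :=
    { obj := k
      arr g := k (X.src g)
      src_arr _ := rfl
      tgt_arr := hinv
      arr_one x := congrArg k (X.src_one x)
      arr_comp g g' e := congrArg k (X.src_comp g g' e)
      continuous_obj := k.continuous
      continuous_arr := k.continuous.comp X.continuous_src }
  have := (shGeom Φ).leftExact
  obtain ⟨e⟩ := nonempty_iso_of_support_eq h.adj (shGeom Φ).adj fun U =>
    (hk U).trans (support_inverseImage_openSheaf Φ U).symm
  exact ⟨Φ, ⟨GeomMorphism.isoMk e⟩⟩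

end GeometricMorphismsToSpaces

end Sh

variable {X Y : TopGrpd.{u}} {S : Type u} [TopologicalSpace S]

section FiberMap

variable {Φ Ψ : ContFunctor X Y}

/-- The map `W_{Φ(x)} → W_{Ψ(x)}` between the fibres of a sheaf which is induced by a transformation
of inverse images. -/
def fiberMap (α : Sh.inverseImage Φ ⟶ Sh.inverseImage Ψ) (W : Sh Y) (x : X.Obj) (w : W)
    (e : Φ.obj x = W.proj w) : W :=
  (Sh.Hom.toFun (α.app W) (⟨(x, w), e⟩ : (Sh.invObj Φ W).carrier) : (Sh.invObj Ψ W).carrier).1.2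

lemma toFun_app_eq (α : Sh.inverseImage Φ ⟶ Sh.inverseImage Ψ) (W : Sh Y)
    (p : (Sh.invObj Φ W).carrier) :
    (Sh.Hom.toFun (α.app W) p : (Sh.invObj Ψ W).carrier).1 =
      (p.1.1, fiberMap α W p.1.1 p.1.2 p.2) :=
  Prod.ext (Sh.Hom.proj_toFun (α.app W) p) rfl

lemma proj_fiberMap (α : Sh.inverseImage Φ ⟶ Sh.inverseImage Ψ) (W : Sh Y) (x : X.Obj) (w : W)
    (e : Φ.obj x = W.proj w) : Ψ.obj x = W.proj (fiberMap α W x w e) := by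
  let q : (Sh.invObj Ψ W).carrier := Sh.Hom.toFun (α.app W) (⟨(x, w), e⟩ : (Sh.invObj Φ W).carrier)
  have hq : q.1.1 = x := Sh.Hom.proj_toFun (α.app W) _
  exact (congrArg Ψ.obj hq).symm.trans q.2

lemma fiberMap_naturality (α : Sh.inverseImage Φ ⟶ Sh.inverseImage Ψ) {V W : Sh Y} (f : V ⟶ W)
    (x : X.Obj) (v : V) (e : Φ.obj x = V.proj v) :
    fiberMap α W x (Sh.Hom.toFun f v) (e.trans (Sh.Hom.proj_toFun f v).symm) =
      Sh.Hom.toFun f (fiberMap α V x v e) :=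
  congrArg (fun p : (Sh.invObj Ψ W).carrier => p.1.2)
    (Sh.congr_toFun (α.naturality f) (⟨(x, v), e⟩ : (Sh.invObj Φ V).carrier))

lemma fiberMap_act (α : Sh.inverseImage Φ ⟶ Sh.inverseImage Ψ) (W : Sh Y) (g : X.Arr) (w : W)
    (e : Φ.obj (X.src g) = W.proj w) :
    fiberMap α W (X.tgt g) (W.act (Φ.arr g) w ((Φ.src_arr g).trans e))
        ((Φ.tgt_arr g).symm.trans (W.str.proj_act _ _ _).symm) =
      W.act (Ψ.arr g) (fiberMap α W (X.src g) w e)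
        ((Ψ.src_arr g).trans (proj_fiberMap α W _ w e)) :=
  congrArg (fun p : (Sh.invObj Ψ W).carrier => p.1.2)
    (Sh.Hom.map_act (α.app W) g (⟨(X.src g, w), e⟩ : (Sh.invObj Φ W).carrier) rfl)

lemma inverseImageMap_eq_iff {a : ContTrans Φ Ψ} {α : Sh.inverseImage Φ ⟶ Sh.inverseImage Ψ} :
    Sh.inverseImageMap a = α ↔ ∀ (W : Sh Y) (x : X.Obj) (w : W) (e : Φ.obj x = W.proj w),
      fiberMap α W x w e = W.act (a.app x) w ((a.src_app x).trans e) := by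
  constructor
  · rintro rfl W x w e
    rfl
  · intro h
    ext W p
    refine Subtype.ext (Eq.trans ?_ (toFun_app_eq α W p).symm)
    exact Prod.ext rfl (h W p.1.1 p.1.2 p.2).symm

end FiberMap

section Disc

variable {Φ Ψ : ContFunctor X (disc S)}

lemma obj_specializes (α : Sh.inverseImage Φ ⟶ Sh.inverseImage Ψ) (x : X.Obj) :
    Ψ.obj x ⤳ Φ.obj x := by
  refine specializes_iff_forall_open.2 fun U hU h => ?_
  have hle := Sh.support_mono (α.app (Sh.openSheaf ⟨U, hU⟩))
  rw [Sh.support_inverseImage_openSheaf, Sh.support_inverseImage_openSheaf] at hle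
  exact @hle x h

lemma obj_eq_of_iso [T0Space S] (e : shGeom Φ ≅ shGeom Ψ)
    (x : X.Obj) : Φ.obj x = Ψ.obj x :=
  Inseparable.eq (X := S) ((obj_specializes e.inv x).antisymm (obj_specializes e.hom x))

/-- The identity on fibres, as a transformation between the inverse images along two continuous
functors into a space which agree on objects. -/
def inverseImageCongr (h : ∀ x, Φ.obj x = Ψ.obj x) : Sh.inverseImage Φ ⟶ Sh.inverseImage Ψ where
  app W :=
    { toFun p := ⟨p.1, (h p.1.1).symm.trans p.2⟩
      continuous_toFun := continuous_subtype_val.subtype_mk _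
      proj_toFun _ := rfl
      map_act g p e := Subtype.ext <| Prod.ext rfl <|
        (Sh.act_disc W _ _ _).trans (Sh.act_disc W _ _ _).symm }

lemma eq_inverseImageCongr (α : Sh.inverseImage Φ ⟶ Sh.inverseImage Ψ)
    (h : ∀ x, Φ.obj x = Ψ.obj x) : α = inverseImageCongr h := by
  apply NatTrans.ext
  funext W
  apply Sh.hom_ext
  rintro ⟨⟨x, w⟩, e⟩
  obtain ⟨⟨U, σ⟩, z, rfl⟩ := Sh.jointlySurjective_sections W w
  have hz : Φ.obj x = z.1 := e.trans (Sh.Hom.proj_toFun σ z)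
  have hσ : fiberMap α (Sh.openSheaf U) x z hz = z :=
    Subtype.ext ((proj_fiberMap α (Sh.openSheaf U) x z hz).symm.trans ((h x).symm.trans hz))
  refine Subtype.ext ((toFun_app_eq α W _).trans (Prod.ext rfl ?_))
  exact (fiberMap_naturality α σ x z hz).trans (congrArg _ hσ)

end Disc

section ArrowSpace

lemma nonempty_toConeFunctor_hom {k k' : ContFunctor (disc S) (disc Y.Arr)}
    (hs : ∀ x, Y.src (k.obj x) = Y.src (k'.obj x)) (ht : ∀ x, Y.tgt (k.obj x) = Y.tgt (k'.obj x))
    (h : ∀ (x : S) (W : Sh Y) (w : W) (e : Y.src (k.obj x) = W.proj w),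
      W.act (k.obj x) w e = W.act (k'.obj x) w ((hs x).symm.trans e)) :
    Nonempty ((GeomMorphism.toConeFunctor (Sh (disc S)) (squareIso Y)).obj (shGeom k) ⟶
      (GeomMorphism.toConeFunctor (Sh (disc S)) (squareIso Y)).obj (shGeom k')) := by
  let lift {f : Y.Arr → Y.Obj} (hf : Continuous f) (hk : ∀ x, f (k.obj x) = f (k'.obj x)) :
      Sh.inverseImage (discMap f hf) ⋙ Sh.inverseImage k ⟶
        Sh.inverseImage (discMap f hf) ⋙ Sh.inverseImage k' :=
    (Sh.inverseImageComp _ _).hom ≫ inverseImageCongr (Φ := k.comp (discMap f hf))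
      (Ψ := k'.comp (discMap f hf)) hk ≫ (Sh.inverseImageComp _ _).inv
  refine ⟨⟨lift Y.continuous_src hs, lift Y.continuous_tgt ht, ?_⟩⟩
  apply NatTrans.ext
  funext W
  apply Sh.hom_ext
  rintro ⟨⟨x, ⟨⟨g, ⟨⟨y, w⟩, hw⟩⟩, hy⟩⟩, hg⟩
  change k.obj x = g at hg
  subst hg
  change Y.src (k.obj x) = y at hy
  subst hy
  apply Subtype.ext
  refine Prod.ext rfl (Subtype.ext (Prod.ext rfl (Subtype.ext (Prod.ext ?_ ?_))))
  · exact (ht x).symm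
  · exact (h x W w hw).symm

lemma isEquivalence_toConeFunctor (hY : IsBipullbackWEP (squareIso Y)) :
    (GeomMorphism.toConeFunctor (Sh (disc S)) (squareIso Y)).IsEquivalence :=
  hY _ Sh.isGrothendieckTopos_disc Sh.toposHasEnoughPoints_disc

lemma arr_specializes_of_act_eq (hY : IsBipullbackWEP (squareIso Y)) {g g' : Y.Arr}
    (hs : Y.src g = Y.src g') (ht : Y.tgt g = Y.tgt g')
    (h : ∀ (W : Sh Y) (w : W) (e : Y.src g = W.proj w),
      W.act g w e = W.act g' w (hs.symm.trans e)) :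
    g' ⤳ g := by
  have := isEquivalence_toConeFunctor (S := PUnit.{u + 1}) hY
  obtain ⟨m⟩ := nonempty_toConeFunctor_hom (S := PUnit.{u + 1})
    (k := discMap (fun _ => g) continuous_const) (k' := discMap (fun _ => g') continuous_const)
    (fun _ => hs) (fun _ => ht) (fun _ => h)
  exact obj_specializes ((GeomMorphism.toConeFunctor _ (squareIso Y)).preimage m) PUnit.unit

lemma arr_ext_of_act_eq [T0Space Y.Arr] (hY : IsBipullbackWEP (squareIso Y)) {g g' : Y.Arr}
    (hs : Y.src g = Y.src g') (ht : Y.tgt g = Y.tgt g')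
    (h : ∀ (W : Sh Y) (w : W) (e : Y.src g = W.proj w),
      W.act g w e = W.act g' w (hs.symm.trans e)) :
    g = g' :=
  (arr_specializes_of_act_eq hY hs.symm ht.symm fun W w e => (h W w (hs.trans e)).symm).antisymm
    (arr_specializes_of_act_eq hY hs ht h) |>.eq

lemma inverseImageMap_injective [T0Space Y.Arr] (hY : IsBipullbackWEP (squareIso Y))
    {Φ Ψ : ContFunctor X Y} :
    Function.Injective (Sh.inverseImageMap : ContTrans Φ Ψ → _) := by
  intro a b h
  refine ContTrans.ext (funext fun x => ?_)
  exact arr_ext_of_act_eq hY ((a.src_app x).trans (b.src_app x).symm)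
    ((a.tgt_app x).trans (b.tgt_app x).symm) fun W w e =>
      inverseImageMap_eq_iff.1 h.symm W x w ((a.src_app x).symm.trans e)

lemma t0Space_obj [T0Space Y.Arr] : T0Space Y.Obj :=
  (Function.LeftInverse.isEmbedding Y.src_one Y.continuous_src Y.continuous_one).t0Space

lemma exists_discMap_comp_fromObj_eq (Φ : ContFunctor (disc S) Y) :
    ∃ (f : S → Y.Obj) (hf : Continuous f), (discMap f hf).comp (fromObj Y) = Φ := by
  obtain ⟨f, arr, _, _, arr_one, _, hf, _⟩ := Φ
  obtain rfl : arr = fun x => Y.one (f x) := funext arr_one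
  exact ⟨f, hf, rfl⟩

section Cone

variable {p q : S → Y.Obj} {hp : Continuous p} {hq : Continuous q}

/-- The cone over the square of `Y` with vertex `Sh(S)` given by two continuous maps `S → Y₀` and an
isomorphism of the induced geometric morphisms to `Sh(Y)`. -/
noncomputable def coneOfIso (α : Sh.inverseImage ((discMap p hp).comp (fromObj Y)) ≅
    Sh.inverseImage ((discMap q hq).comp (fromObj Y))) :
    CategoricalPullback (GeomMorphism.postcomp (Sh (disc S)) (shGeom (fromObj Y)))
      (GeomMorphism.postcomp (Sh (disc S)) (shGeom (fromObj Y))) where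
  fst := shGeom (discMap p hp)
  snd := shGeom (discMap q hq)
  iso := shComp _ _ ≪≫ GeomMorphism.isoMk (f := shGeom _) (g := shGeom _) α ≪≫ (shComp _ _).symm

variable {α : Sh.inverseImage ((discMap p hp).comp (fromObj Y)) ≅
  Sh.inverseImage ((discMap q hq).comp (fromObj Y))}

lemma exists_iso_coneOfIso [T0Space Y.Arr] [QuasiSober Y.Arr]
    (hY : IsBipullbackWEP (squareIso Y)) :
    ∃ k : ContFunctor (disc S) (disc Y.Arr), Nonempty ((GeomMorphism.toConeFunctor (Sh (disc S))
      (squareIso Y)).obj (shGeom k) ≅ coneOfIso α) := by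
  have := isEquivalence_toConeFunctor (S := S) hY
  let F := GeomMorphism.toConeFunctor (Sh (disc S)) (squareIso Y)
  obtain ⟨k, ⟨e⟩⟩ := Sh.exists_iso_shGeom (F.objPreimage (coneOfIso α))
  exact ⟨k, ⟨(F.mapIso e).symm ≪≫ F.objObjPreimageIso _⟩⟩

lemma fiberMap_eq_act {k : ContFunctor (disc S) (disc Y.Arr)}
    (m : (GeomMorphism.toConeFunctor (Sh (disc S)) (squareIso Y)).obj (shGeom k) ⟶ coneOfIso α)
    (hs : ∀ x, Y.src (k.obj x) = p x) (ht : ∀ x, Y.tgt (k.obj x) = q x) (W : Sh Y) (x : S) (w : W)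
    (e : p x = W.proj w) : fiberMap α.hom W x w e = W.act (k.obj x) w ((hs x).trans e) := by
  have hfst : m.fst = (Sh.inverseImageComp k (discMap Y.src Y.continuous_src)).hom ≫
    inverseImageCongr (Ψ := discMap p hp) hs := (Iso.inv_comp_eq _).1 (eq_inverseImageCongr _ hs)
  have hsnd : m.snd = (Sh.inverseImageComp k (discMap Y.tgt Y.continuous_tgt)).hom ≫
    inverseImageCongr (Ψ := discMap q hq) ht := (Iso.inv_comp_eq _).1 (eq_inverseImageCongr _ ht)
  let pt : (Sh.invObj k (Sh.invObj (discMap Y.src Y.continuous_src)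
    (Sh.invObj (fromObj Y) W))).carrier :=
      ⟨(x, ⟨(k.obj x, ⟨(Y.src (k.obj x), w), (hs x).trans e⟩), rfl⟩), rfl⟩
  have hm := m.w
  rw [hfst, hsnd] at hm
  have := Sh.congr_toFun (NatTrans.congr_app hm W) pt
  exact congrArg (fun r : (Sh.invObj (discMap q hq) (Sh.invObj (fromObj Y) W)).carrier =>
    r.1.2.1.2) this

end Cone

lemma exists_inverseImageMap_eq_of_disc [T0Space Y.Arr] [QuasiSober Y.Arr]
    (hY : IsBipullbackWEP (squareIso Y)) {Φ Ψ : ContFunctor (disc S) Y}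
    (α : Sh.inverseImage Φ ≅ Sh.inverseImage Ψ) :
    ∃ a : ContTrans Φ Ψ, Sh.inverseImageMap a = α.hom := by
  have := t0Space_obj (Y := Y)
  obtain ⟨p, hp, rfl⟩ := exists_discMap_comp_fromObj_eq Φ
  obtain ⟨q, hq, rfl⟩ := exists_discMap_comp_fromObj_eq Ψ
  obtain ⟨k, ⟨i⟩⟩ := exists_iso_coneOfIso (α := α) hY
  have hs : ∀ x, Y.src (k.obj x) = p x :=
    obj_eq_of_iso (Ψ := discMap p hp)
      ((shComp k _).symm ≪≫ (CategoricalPullback.π₁ _ _).mapIso i)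
  have ht : ∀ x, Y.tgt (k.obj x) = q x :=
    obj_eq_of_iso (Ψ := discMap q hq)
      ((shComp k _).symm ≪≫ (CategoricalPullback.π₂ _ _).mapIso i)
  let a : ContTrans ((discMap p hp).comp (fromObj Y)) ((discMap q hq).comp (fromObj Y)) :=
    { app := k.obj
      src_app := hs
      tgt_app := ht
      naturality x :=
        (comp_congr (congrArg Y.one (hs x).symm) rfl _ _).trans <|
          (Y.one_comp (k.obj x)).trans <| (Y.comp_one (k.obj x)).symm.trans <|
            comp_congr rfl (congrArg Y.one (ht x)) _ _
      continuous_app := k.continuous_obj }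
  exact ⟨a, inverseImageMap_eq_iff.2 (fiberMap_eq_act i.hom hs ht)⟩

/-- The restriction of an isomorphism of inverse images to the space of objects. -/
def restrictObj {Φ Ψ : ContFunctor X Y} (α : Sh.inverseImage Φ ≅ Sh.inverseImage Ψ) :
    Sh.inverseImage ((fromObj X).comp Φ) ≅ Sh.inverseImage ((fromObj X).comp Ψ) :=
  (Sh.inverseImageComp _ Φ).symm ≪≫ Functor.isoWhiskerRight α _ ≪≫ Sh.inverseImageComp _ Ψ

lemma exists_inverseImageMap_eq [T0Space Y.Arr] [QuasiSober Y.Arr]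
    (hY : IsBipullbackWEP (squareIso Y)) {Φ Ψ : ContFunctor X Y}
    (α : Sh.inverseImage Φ ≅ Sh.inverseImage Ψ) :
    ∃ a : ContTrans Φ Ψ, Sh.inverseImageMap a = α.hom := by
  obtain ⟨b, hb⟩ := exists_inverseImageMap_eq_of_disc hY (restrictObj α)
  have hs (x : X.Obj) : Y.src (b.app x) = Φ.obj x := b.src_app x
  have ht (x : X.Obj) : Y.tgt (b.app x) = Ψ.obj x := b.tgt_app x
  have hact (W : Sh Y) (x : X.Obj) (w : W) (e : Φ.obj x = W.proj w) :
      fiberMap α.hom W x w e = W.act (b.app x) w ((hs x).trans e) :=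
    inverseImageMap_eq_iff.1 hb W x w e
  refine ⟨⟨b.app, hs, ht, fun g => ?_, b.continuous_app⟩, inverseImageMap_eq_iff.2 hact⟩
  refine arr_ext_of_act_eq hY (by simp [hs]) (by simp [ht]) fun W w e => ?_
  have e' : Φ.obj (X.src g) = W.proj w := by rw [← Φ.src_arr g, ← e, Y.src_comp]
  have hg := fiberMap_act α.hom W g w e'
  rw [hact] at hg
  refine (W.str.act_comp _ _ _ _ _).symm.trans (hg.trans ?_)
  refine (Sh.act_congr W rfl (hact W _ w e') _ ?_).trans (W.str.act_comp _ _ _ _ _)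
  simp [ht]

end ArrowSpace

end TopGrpd

theorem mainTheorem5_general (X Y : TopGrpd.{u}) [T0Space Y.Arr] [QuasiSober Y.Arr]
    (hY : IsBipullbackWEP (TopGrpd.squareIso Y)) :
    (TopGrpd.shIso X Y).Full ∧ (TopGrpd.shIso X Y).Faithful := by
  refine ⟨⟨fun {Φ Ψ} f => ?_⟩, ⟨fun {Φ Ψ a b} h => ?_⟩⟩
  · let α : TopGrpd.Sh.inverseImage Φ ≅ TopGrpd.Sh.inverseImage Ψ :=
      ⟨f.iso.hom, f.iso.inv, f.iso.hom_inv_id, f.iso.inv_hom_id⟩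
    obtain ⟨a, ha⟩ := TopGrpd.exists_inverseImageMap_eq hY α
    exact ⟨a, CoreHom.ext (Iso.ext ha)⟩
  · exact TopGrpd.inverseImageMap_injective hY (congrArg (fun f => f.iso.hom) h)

theorem mainTheorem5 (X Y : TopGrpd.{u}) (hX : X.IsEtaleComplete) (hY : Y.IsEtaleComplete) :
    (TopGrpd.shIso X Y).Full ∧ (TopGrpd.shIso X Y).Faithful := by
  have := hY.t0_arr
  have := hY.quasiSober_arr
  exact mainTheorem5_general X Y hY.isBipullback
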